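/- **Setting.** Let $\mathsf{ID}$ be a linearly ordered set of identifiers and $\mathsf{Char}$ a set of characters. An *event* is a triple $e=(e.\mathit{id},e.\mathit{parents},e.\mathit{op})$ of an ID, a finite set of parent IDs, and an operation $\mathit{Insert}(i,c)$ or $\mathit{Delete}(i)$ with $i\in\mathbb N$ (indexes start at $0$), $c\in\mathsf{Char}$. An *event graph* $G$ is a finite set of events; $a\to b$ ("$a$ happened before $b$") means that there is a nonempty path from $a$ to $b$ along parent-to-child edges in $G$. For a set $V$ of event IDs, $\mathsf{Events}(V)$ consists of the events of $G$ with ID in $V$ and all events that happened before one of them; $\mathsf{Version}(G)$ is the set of events of $G$ that did not happen before any event of $G$. $V$ is a *critical version* of $G$ if every event of $\mathsf{Events}(V)$ happened before every event of $G\setminus\mathsf{Events}(V)$. **Eg-walker.** $\mathsf{replay}(G)$ processes the events of $G$ in some topologically sorted order (the choice is an arbitrary function of $G$), starting with the empty document, the empty internal state and the empty prepare version. A document is a sequence of pairs $(\mathit{id},c)$, where $\mathit{id}$ is the ID of the event that inserted $c$. The internal state consists of a sequence of records (each with an ID and states $s_p\in\{\mathtt{NotInsertedYet},\mathtt{Ins},\mathtt{Del}\,1,\mathtt{Del}\,2,\dots\}$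 and $s_e\in\{\mathtt{Ins},\mathtt{Del}\}$) and placeholders (each standing for a number, possibly $\infty$, of characters that are visible in both the prepare and the effect version), and of a map from event IDs to the records they inserted or deleted. A record is visible in the prepare (effect) version if $s_p=\mathtt{Ins}$ ($s_e=\mathtt{Ins}$). An event $e$ is processed as follows. * *Retreat and advance.* Every event that is in $\mathsf{Events}$ of the current prepare version but not in $\mathsf{Events}(e.\mathit{parents})$ is retreated (in reverse processing order), then every event in the latter but not in the former is advanced (in processing order). Advancing moves $s_p$ of the event's record one step along $\mathtt{NotInsertedYet},\mathtt{Ins},\mathtt{Del}\,1,\mathtt{Del}\,2,\dots$; retreating moves it one step back. * *Apply $\mathit{Insert}(i,c)$.* Go to the position directly after the first $i$ characters visible in the prepare version (splitting a placeholder if necessary), skip as many records of the maximal run of $\mathtt{NotInsertedYet}$ records at that position as the integration rule of the list CRDT says, and insert a record with the ID of $e$ and $s_p=s_e=\mathtt{Ins}$. The transformed operation is $\mathit{Insert}(i',c)$, where $i'$ is the number of characters before the new record that are visible in the effect version. * *Apply $\mathit{Delete}(i)$.* Take the character with index $i$ among those visible in the prepare version. If it is in a placeholder, split a record for it off the placeholder,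 with $s_p=\mathtt{Del}\,1$, $s_e=\mathtt{Del}$ and a locally unique ID; otherwise advance $s_p$ of its record by one step and set $s_e=\mathtt{Del}$. The transformed operation is $\mathit{Delete}(i')$, where $i'$ is the number of characters before it that are visible in the effect version, or a no-op if its record already had $s_e=\mathtt{Del}$. The transformed operation is applied to the document, and the prepare version becomes $\{e\}$. There are two optional optimisations, each used at an arbitrary choice of the places where it is allowed (in particular never, or always): (i) whenever the version of the set of events processed so far is critical in $G$, the internal state may be cleared, i.e. replaced by a single placeholder of length $\infty$, with that version as its prepare version; (ii) if both $\{e\}$ and $e.\mathit{parents}$ are critical versions of $G$, $e$ may be emitted untransformed, without touching the internal state, which is then cleared. **Integration rules.** An *integration rule* is a function that, from the new insertion event and the records of the run, each given with the set of events that happened before it, computes the number of records to skip. It is a *list CRDT* if in the replay, without clearing, of a valid event graph, after any initial part of the replay, applying two concurrent insertions $a,b$ in the order $a,b$ or in the order $b,a$ leads to the same sequence of record IDs. *RGA* is the rule that skips the leading records of the run whose timestamp is greater than that of the new insertion, where the timestamp of an event $x$ is the pair $(|\{y: y\to x\}|,\,x.\mathit{id})$, ordered lexicographically. **Valid graphs.**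 $G$ is *valid* if its events have distinct IDs, every parent ID of an event is the ID of another event of $G$, $G$ is acyclic, and for every $e\in G$ the index of $e.\mathit{op}$ exists in the document $\mathsf{replay}(\mathsf{Events}(e.\mathit{parents}))$ (it is at most the length for an insertion, and less than the length for a deletion). **Strong list specification.** A replay function satisfies it if for every valid event graph $G$ there is a relation $\mathit{lo}\subseteq\mathsf{ID}\times\mathsf{ID}$ that is transitive, irreflexive and total (any two distinct IDs are related one way or the other) such that for every $e\in G$, with $G_e=\{e\}\cup\mathsf{Events}(e.\mathit{parents})$ and $\mathit{doc}_e=\mathsf{replay}(G_e)$: 1. $(\mathit{id},c)$ occurs in $\mathit{doc}_e$ if and only if some $a\in G_e$ has $a.\mathit{id}=\mathit{id}$ and $a.\mathit{op}=\mathit{Insert}(j,c)$ for some $j$, and there are no $b\in G_e$ and $k$ with $b.\mathit{op}=\mathit{Delete}(k)$ and $\mathsf{replay}(\mathsf{Events}(b.\mathit{parents}))[k]=(\mathit{id},c)$; 2. if $\mathit{doc}_e[i]=(\mathit{id}_i,c_i)$, $\mathit{doc}_e[j]=(\mathit{id}_j,c_j)$ and $i<j$, then $(\mathit{id}_i,\mathit{id}_j)\in\mathit{lo}$;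 3. if $e.\mathit{op}=\mathit{Insert}(i,c)$, then $\mathit{doc}_e[i]=(e.\mathit{id},c)$. **Theorem.** For every list CRDT integration rule, every choice of topologically sorted orders, and every choice of where to use the optimisations (i) and (ii), the Eg-walker replay function satisfies the strong list specification. Moreover, RGA is a list CRDT, so that the conclusion holds unconditionally for Eg-walker with RGA. -/

import Mathlib

namespace EgWalker

noncomputable section

open scoped Classical

universe u v

/-! ## Event graphs -/

/-- Editing operations on a sequence of characters of type `C`; indexes start at zero. -/
inductive Op (C : Type v) where
  | insert (i : ℕ) (c : C)
  | delete (i : ℕ)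

/-- An event: a unique ID, the set of IDs of its parents, and an operation. -/
structure Evt (ID : Type u) (C : Type v) where
  id : ID
  parents : Finset ID
  op : Op C

/-- An event graph is a finite set of events; the edges are given by the parent IDs. -/
abbrev EventGraph (ID : Type u) (C : Type v) := Finset (Evt ID C)

variable {ID : Type u} {C : Type v}

def Evt.IsInsert (e : Evt ID C) : Prop := ∃ i c, e.op = Op.insert i c

/-- `a` is a parent of `b` in `G`. -/
def IsParent (G : EventGraph ID C) (a b : Evt ID C) : Prop :=
  a ∈ G ∧ b ∈ G ∧ a.id ∈ b.parents

/-- `a` happened before `b`: there is a nonempty directed path from `a` to `b`. -/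
def HappenedBefore (G : EventGraph ID C) : Evt ID C → Evt ID C → Prop :=
  Relation.TransGen (IsParent G)

/-- `Events(V)`: the events of the version `V` (a set of event IDs) and all events that happened
before one of them. -/
def events (G : EventGraph ID C) (V : Finset ID) : EventGraph ID C :=
  G.filter fun a => a.id ∈ V ∨ ∃ b ∈ G, b.id ∈ V ∧ HappenedBefore G a b

/-- `Version(G)`: the (IDs of the) events of `G` that did not happen before any event of `G`. -/
def version (G : EventGraph ID C) : Finset ID :=
  (G.filter fun a => ∀ b ∈ G, ¬ HappenedBefore G a b).image Evt.id

/-- `V` is a critical version of `G`: all events in `Events(V)` happened before all other events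
of `G`. -/
def IsCritical (G : EventGraph ID C) (V : Finset ID) : Prop :=
  ∀ a ∈ events G V, ∀ b ∈ G, b ∉ events G V → HappenedBefore G a b

/-- `es` enumerates the events of `G`, each exactly once, in a topologically sorted order. -/
structure IsTopSort (G : EventGraph ID C) (es : List (Evt ID C)) : Prop where
  nodup : es.Nodup
  mem_iff : ∀ e, e ∈ es ↔ e ∈ G
  causal : es.Pairwise fun a b => ¬ HappenedBefore G b a

/-- `sort` returns a topologically sorted order of every event graph that has one. -/
def IsSorter (sort : EventGraph ID C → List (Evt ID C)) : Prop :=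
  ∀ G, (∃ es, IsTopSort G es) → IsTopSort G (sort G)

/-! ## Documents -/

/-- A document state: each character comes with the ID of the event that inserted it. -/
abbrev Doc (ID : Type u) (C : Type v) := List (ID × C)

/-- Apply a transformed operation (`none` is a no-op) that stems from the event with the given
ID. -/
def applyOp (doc : Doc ID C) (id : ID) : Option (Op C) → Doc ID C
  | none => doc
  | some (Op.insert i c) => doc.insertIdx i (id, c)
  | some (Op.delete i) => doc.eraseIdx i

/-! ## The internal state -/

/-- A record of the internal state. `evt` is the event that created it, and `evt.id` is the ID of
the record. That event is either the insertion of the character or, for a character that was part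
of a placeholder, the deletion that split the record off the placeholder, so that the record has a
locally unique placeholder ID. -/
structure Record (ID : Type u) (C : Type v) where
  evt : Evt ID C
  /-- the set of events that happened before `evt` -/
  past : EventGraph ID C
  /-- state in the prepare version: `0` is `NotInsertedYet`, `1` is `Ins`, `n + 1` is `Del n` -/
  sp : ℕ
  /-- state in the effect version: `false` is `Ins`, `true` is `Del` -/
  deleted : Bool

/-- An entry of the internal state: a record, or a placeholder for `len` unknown characters
(`⊤` for an unbounded range). -/
inductive Item (ID : Type u) (C : Type v) where
  | record (r : Record ID C)
  | placeholder (len : ℕ∞)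

/-- The number of characters of an entry that are visible in the effect version. -/
def Item.effLen : Item ID C → ℕ∞
  | .record r => if r.deleted then 0 else 1
  | .placeholder n => n

/-- Does the entry contain a character that is visible in the prepare version? -/
def Item.prepVisible : Item ID C → Bool
  | .record r => decide (r.sp = 1)
  | .placeholder n => decide (n ≠ 0)

/-- The number of characters visible in the effect version. -/
def effIndex (s : List (Item ID C)) : ℕ := ((s.map Item.effLen).sum).toNat

/-- Split the sequence directly after the `i`th character that is visible in the prepare version
(at the beginning for `i = 0`). A placeholder that contains this position is split in two. -/
def splitPrep : ℕ → List (Item ID C) → List (Item ID C) × List (Item ID C)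
  | 0, s => ([], s)
  | _ + 1, [] => ([], [])
  | i + 1, .record r :: s =>
      let pq := splitPrep (if r.sp = 1 then i else i + 1) s
      (.record r :: pq.1, pq.2)
  | i + 1, .placeholder n :: s =>
      if ((i + 1 : ℕ) : ℕ∞) < n then
        ([.placeholder ((i + 1 : ℕ) : ℕ∞)], .placeholder (n - ((i + 1 : ℕ) : ℕ∞)) :: s)
      else
        let pq := splitPrep (i + 1 - n.toNat) s
        (.placeholder n :: pq.1, pq.2)

/-- The maximal run of `NotInsertedYet` records at the front of the sequence. -/
def notInsertedRun : List (Item ID C) → List (Record ID C)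
  | .record r :: s => if r.sp = 0 then r :: notInsertedRun s else []
  | _ => []

/-- The insertion generated by an event, as a list CRDT sees it: the event together with the set
of events that happened before it. All fields that a CRDT attaches to an insertion when it is
generated (timestamps, origins) are functions of these data. -/
structure InsertOp (ID : Type u) (C : Type v) where
  evt : Evt ID C
  past : EventGraph ID C

def Record.insertOp (r : Record ID C) : InsertOp ID C := ⟨r.evt, r.past⟩

/-- The ordering rule of a list CRDT for concurrent insertions at the same position: given the
run of `NotInsertedYet` records that follows the insertion position and the new insertion, `skip`
is the number of records of that run to skip before inserting. -/
structure IntegrationRule (ID : Type u) (C : Type v) where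
  skip : List (InsertOp ID C) → InsertOp ID C → ℕ

/-- The internal state. -/
structure State (ID : Type u) (C : Type v) where
  /-- the sequence of records and placeholders -/
  items : List (Item ID C)
  /-- the map from the ID of an applied event to the ID of the record it inserted or deleted -/
  target : ID → Option ID
  /-- the current prepare version -/
  prep : Finset ID

/-- Change the prepare state of the record that was inserted or deleted by `e`. -/
def State.modifyTarget (st : State ID C) (e : Evt ID C) (f : ℕ → ℕ) : State ID C :=
  { st with
    items := st.items.map fun x => match x with
      | .record r => if st.target e.id = some r.evt.id then .record { r with sp := f r.sp }
          else .record r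
      | .placeholder n => .placeholder n }

/-- `retreat(e)`, as far as the records are concerned: `Ins` becomes `NotInsertedYet`, `Del 1`
becomes `Ins`, and `Del (n + 1)` becomes `Del n`. -/
def State.retreat (st : State ID C) (e : Evt ID C) : State ID C := st.modifyTarget e (· - 1)

/-- `advance(e)`, the opposite of `retreat(e)`. -/
def State.advance (st : State ID C) (e : Evt ID C) : State ID C := st.modifyTarget e (· + 1)

/-- Move the prepare version to `V`. `done` is the list of events processed so far, in the order
of processing. -/
def State.prepare (G : EventGraph ID C) (done : List (Evt ID C)) (V : Finset ID)
    (st : State ID C) : State ID C :=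
  let old := events G st.prep
  let new := events G V
  let st₁ := (done.reverse.filter fun e => decide (e ∈ old ∧ e ∉ new)).foldl State.retreat st
  let st₂ := (done.filter fun e => decide (e ∈ new ∧ e ∉ old)).foldl State.advance st₁
  { st₂ with prep := V }

/-- `apply(e)` for an event `e` with operation `Insert(i, c)`; returns the new internal state and
the transformed operation. -/
def State.applyInsert (R : IntegrationRule ID C) (st : State ID C) (e : Evt ID C)
    (past : EventGraph ID C) (i : ℕ) (c : C) : State ID C × Option (Op C) :=
  let pq := splitPrep i st.items
  let run := notInsertedRun pq.2
  let k := min (R.skip (run.map Record.insertOp) ⟨e, past⟩) run.length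
  let before := pq.1 ++ pq.2.take k
  ({ items := before ++ .record ⟨e, past, 1, false⟩ :: pq.2.drop k
     target := Function.update st.target e.id (some e.id)
     prep := {e.id} },
   some (Op.insert (effIndex before) c))

/-- `apply(e)` for an event `e` with operation `Delete(i)`. The character to delete is the first
one after the `i` skipped characters that is visible in the prepare version. If it belongs to a
placeholder, then a record for it is split off. -/
def State.applyDelete (st : State ID C) (e : Evt ID C)
    (past : EventGraph ID C) (i : ℕ) : State ID C × Option (Op C) :=
  let pq := splitPrep i st.items
  let before := pq.1 ++ pq.2.takeWhile fun x => !x.prepVisible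
  match pq.2.dropWhile fun x => !x.prepVisible with
  | [] => ({ st with prep := {e.id} }, none)
  | .record r :: rest =>
      ({ items := before ++ .record { r with sp := r.sp + 1, deleted := true } :: rest
         target := Function.update st.target e.id (some r.evt.id)
         prep := {e.id} },
       if r.deleted then none else some (Op.delete (effIndex before)))
  | .placeholder n :: rest =>
      ({ items := before ++ .record ⟨e, past, 2, true⟩ ::
           ((if n - 1 = 0 then [] else [.placeholder (n - 1)]) ++ rest)
         target := Function.update st.target e.id (some e.id)
         prep := {e.id} },
       some (Op.delete (effIndex before)))

/-- `apply(e)`, for an internal state whose prepare version is `e.parents`. -/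
def State.apply (R : IntegrationRule ID C) (G : EventGraph ID C) (st : State ID C)
    (e : Evt ID C) : State ID C × Option (Op C) :=
  match e.op with
  | Op.insert i c => st.applyInsert R e (events G e.parents) i c
  | Op.delete i => st.applyDelete e (events G e.parents) i

/-- The internal state at the start of a replay. -/
def State.empty : State ID C := ⟨[], fun _ => none, ∅⟩

/-- The internal state after clearing it at the version `V`: a single placeholder of unknown
length. -/
def State.cleared (V : Finset ID) : State ID C := ⟨[.placeholder ⊤], fun _ => none, V⟩

/-! ## The replay function -/

/-- When to use the optional optimisations at critical versions. Both fields get the event graph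
and the list of events processed so far. -/
structure ClearingPolicy (ID : Type u) (C : Type v) where
  /-- clear the internal state if the version of the processed events is critical? -/
  clear : EventGraph ID C → List (Evt ID C) → Prop
  /-- emit the next event untransformed if its version and its parent version are critical? -/
  bypass : EventGraph ID C → List (Evt ID C) → Prop

/-- Never use the optimisations. -/
def ClearingPolicy.never : ClearingPolicy ID C := ⟨fun _ _ => False, fun _ _ => False⟩

/-- A replay in progress. -/
structure Walk (ID : Type u) (C : Type v) where
  state : State ID C
  /-- the events processed so far -/
  done : List (Evt ID C)
  /-- the document state resulting from the transformed operations so far -/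
  doc : Doc ID C

/-- Process one event. -/
def Walk.step (R : IntegrationRule ID C) (pol : ClearingPolicy ID C) (G : EventGraph ID C)
    (w : Walk ID C) (e : Evt ID C) : Walk ID C :=
  let done' := w.done ++ [e]
  if pol.bypass G w.done ∧ IsCritical G {e.id} ∧ IsCritical G e.parents then
    { state := State.cleared {e.id}
      done := done'
      doc := applyOp w.doc e.id (some e.op) }
  else
    let res := (w.state.prepare G w.done e.parents).apply R G e
    let V := version done'.toFinset
    { state := if pol.clear G done' ∧ IsCritical G V then State.cleared V else res.1
      done := done'
      doc := applyOp w.doc e.id res.2 }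

/-- Process the events `es` of the event graph `G` in the given order. -/
def walk (R : IntegrationRule ID C) (pol : ClearingPolicy ID C) (G : EventGraph ID C)
    (es : List (Evt ID C)) : Walk ID C :=
  es.foldl (Walk.step R pol G) ⟨State.empty, [], []⟩

/-- The replay function of Eg-walker. -/
def replay (R : IntegrationRule ID C) (pol : ClearingPolicy ID C)
    (sort : EventGraph ID C → List (Evt ID C)) (G : EventGraph ID C) : Doc ID C :=
  (walk R pol G (sort G)).doc

/-! ## The strong list specification -/

/-- `op` inserts or deletes at an index that exists in a document of length `n`. -/
def Op.InBounds (n : ℕ) : Op C → Prop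
  | .insert i _ => i ≤ n
  | .delete i => i < n

/-- Valid event graphs, with respect to a replay function. -/
structure Valid (replay : EventGraph ID C → Doc ID C) (G : EventGraph ID C) : Prop where
  unique_id : ∀ a ∈ G, ∀ b ∈ G, a.id = b.id → a = b
  parents_mem : ∀ e ∈ G, ∀ p ∈ e.parents, ∃ a ∈ G, a ≠ e ∧ a.id = p
  acyclic : ∀ e, ¬ HappenedBefore G e e
  inBounds : ∀ e ∈ G, e.op.InBounds (replay (events G e.parents)).length

/-- The strong list specification, for a replay function. -/
def StrongListSpec (replay : EventGraph ID C → Doc ID C) : Prop :=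
  ∀ G, Valid replay G → ∃ lo : ID → ID → Prop,
    (∀ e ∈ G,
      let Ge := insert e (events G e.parents)
      let doc := replay Ge
      (∀ (id : ID) (c : C), (∃ i : ℕ, doc[i]? = some (id, c)) ↔
        (∃ a ∈ Ge, ∃ j : ℕ, a.id = id ∧ a.op = Op.insert j c) ∧
        ¬ ∃ b ∈ Ge, ∃ k : ℕ, b.op = Op.delete k ∧
          (replay (events G b.parents))[k]? = some (id, c)) ∧
      (∀ (i j : ℕ) (idi : ID) (ci : C) (idj : ID) (cj : C), doc[i]? = some (idi, ci) → doc[j]? = some (idj, cj) →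
        i < j → lo idi idj) ∧
      (∀ (i : ℕ) (c : C), e.op = Op.insert i c → doc[i]? = some (e.id, c))) ∧
    (∀ a b c, lo a b → lo b c → lo a c) ∧
    (∀ a, ¬ lo a a) ∧
    (∀ a b, a ≠ b → lo a b ∨ lo b a)

/-! ## List CRDTs -/

/-- The IDs of the records in a sequence. -/
def recordIds (s : List (Item ID C)) : List ID :=
  s.filterMap fun x => match x with
    | .record r => some r.evt.id
    | .placeholder _ => none

/-- The rule `R` is that of a list CRDT: in the replay (without clearing) of a valid event graph,
after any initial part `es` of the replay, applying two concurrent insertions `a` and `b` in either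
order leads to the same sequence of records. -/
def IntegrationRule.IsListCRDT (R : IntegrationRule ID C) : Prop :=
  ∀ sort, IsSorter sort → ∀ G, Valid (replay R .never sort) G →
    ∀ es a b rest, IsTopSort G (es ++ a :: b :: rest) → ¬ HappenedBefore G a b →
      a.IsInsert → b.IsInsert →
      recordIds (walk R .never G (es ++ [a, b])).state.items =
        recordIds (walk R .never G (es ++ [b, a])).state.items

/-- The timestamp order of RGA: compare the sums of the vector clocks, that is, the numbers of
events that happened before, and break ties by the IDs. -/
def InsertOp.TimestampLT [LinearOrder ID] (a b : InsertOp ID C) : Prop :=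
  a.past.card < b.past.card ∨ (a.past.card = b.past.card ∧ a.evt.id < b.evt.id)

/-- RGA (Replicated Growable Array): skip the records with a greater timestamp. -/
def rga (ID : Type u) (C : Type v) [LinearOrder ID] : IntegrationRule ID C where
  skip run new := (run.takeWhile fun r => decide (new.TimestampLT r)).length

end

end EgWalker

/-!
The proof compares every replay of an event graph with an *abstract replay* (`order`) that only
keeps the sequence of all insertions, deleted ones included, each represented by its event. Which
characters an event sees is then read off from the graph: the state of the character inserted by `x`
in a version is the number of events of that version that insert or delete it (`charState`), where
the target of a deletion at index `k` is the `k`th character of the replay of its past (`targetOf`).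

*Simulation* (`walk_correct`). The internal state of a replay with an arbitrary clearing policy
represents the abstract sequence (`Rep`, `StateOK`). Let `S₀` be the set of events that had been
processed when the state was last cleared. The version was critical, so all later events have `S₀`
in their past. Hence every character of `S₀` that was deleted within `S₀` is invisible to all of them,
and every other one is visible until a later event deletes it, which justifies replacing them all by
a placeholder. The delicate point is that the missing tombstones could separate records that form
one run of `NotInsertedYet` records in the compressed state. This does not happen: a later insertion is
placed directly after a visible character or after another later insertion, so a tombstone of `S₀`
is never followed by an insertion outside of `S₀`.

*Convergence* (`SwapBelow.order_congr`, `convergence`). If two concurrent events can always be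
swapped, then the abstract sequence depends only on the set of events, as an adjacent
transposition argument shows. For a list CRDT the swap property is its definition, transported along
the simulation without clearing. Simulation and convergence depend on each other: the simulation
needs that an event sees the document in which it was generated, which follows from reordering the
events so that its past comes first. They are proved together by induction on the number of events.

*RGA* (`rga_isListCRDT`). A larger timestamp than that of `e` is never found in the past of `e`,
so RGA puts `e` in front of the first smaller timestamp after its left neighbour, and two such
insertions commute (`insertAfterNth_comm`).

*Specification* (`strongListSpec`). Since the replay of each past does not depend on the policy,
neither does validity (`Valid.never`). The required order on IDs is that of the abstract
sequence of the whole graph, of which the sequence of every subgraph is a sublist.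
-/

namespace EgWalker

noncomputable section

open scoped Classical

universe u v

variable {ID : Type u} {C : Type v}

/-! ### Event graphs -/

/-- The part of validity that does not mention the replay function. -/
structure WellFormed (G : EventGraph ID C) : Prop where
  unique_id : ∀ a ∈ G, ∀ b ∈ G, a.id = b.id → a = b
  parents_mem : ∀ e ∈ G, ∀ p ∈ e.parents, ∃ a ∈ G, a ≠ e ∧ a.id = p
  acyclic : ∀ e, ¬ HappenedBefore G e e

theorem Valid.wellFormed {f : EventGraph ID C → Doc ID C} {G : EventGraph ID C}
    (h : Valid f G) : WellFormed G := ⟨h.unique_id, h.parents_mem, h.acyclic⟩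

theorem HappenedBefore.left_mem {G : EventGraph ID C} {a b : Evt ID C}
    (h : HappenedBefore G a b) : a ∈ G := by
  induction h using Relation.TransGen.head_induction_on with
  | single h => exact h.1
  | head h _ _ => exact h.1

theorem HappenedBefore.right_mem {G : EventGraph ID C} {a b : Evt ID C}
    (h : HappenedBefore G a b) : b ∈ G := by
  induction h with
  | single h => exact h.2.1
  | tail _ h _ => exact h.2.1

theorem mem_past {G : EventGraph ID C} {e x : Evt ID C} (he : e ∈ G) :
    x ∈ events G e.parents ↔ HappenedBefore G x e := by
  simp only [events, Finset.mem_filter]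
  constructor
  · rintro ⟨hx, h | ⟨b, hb, hbe, h⟩⟩
    · exact .single ⟨hx, he, h⟩
    · exact .tail h ⟨hb, he, hbe⟩
  · intro h
    refine ⟨h.left_mem, ?_⟩
    cases h with
    | single h => exact Or.inl h.2.2
    | tail h h' => exact Or.inr ⟨_, h'.1, h'.2.2, h⟩

theorem events_subset (G : EventGraph ID C) (V : Finset ID) : events G V ⊆ G :=
  Finset.filter_subset _ _

theorem past_trans {G : EventGraph ID C} {e x : Evt ID C} (he : e ∈ G)
    (hx : x ∈ events G e.parents) : events G x.parents ⊆ events G e.parents := by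
  intro y hy
  have hx' := (mem_past he).1 hx
  exact (mem_past he).2 (((mem_past hx'.left_mem).1 hy).trans hx')

theorem WellFormed.notMem_past {G : EventGraph ID C} (hG : WellFormed G) {e : Evt ID C}
    (he : e ∈ G) : e ∉ events G e.parents := fun h => hG.acyclic e ((mem_past he).1 h)

theorem WellFormed.card_past_lt {G : EventGraph ID C} (hG : WellFormed G) {e x : Evt ID C}
    (he : e ∈ G) (hx : x ∈ events G e.parents) :
    (events G x.parents).card < (events G e.parents).card :=
  Finset.card_lt_card ⟨past_trans he hx, fun h => hG.notMem_past (events_subset _ _ hx) (h hx)⟩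

theorem events_empty (G : EventGraph ID C) : events G ∅ = ∅ := by
  simp [events]

theorem WellFormed.events_singleton {G : EventGraph ID C} (hG : WellFormed G) {e : Evt ID C}
    (he : e ∈ G) : events G {e.id} = insert e (events G e.parents) := by
  ext x
  rw [Finset.mem_insert, mem_past he]
  simp only [events, Finset.mem_filter, Finset.mem_singleton]
  constructor
  · rintro ⟨hx, h | ⟨b, hb, hbe, h⟩⟩
    · exact Or.inl (hG.unique_id _ hx _ he h)
    · rw [hG.unique_id _ hb _ he hbe] at h
      exact Or.inr h
  · rintro (rfl | h)
    · exact ⟨he, Or.inl rfl⟩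
    · exact ⟨h.left_mem, Or.inr ⟨e, he, rfl, h⟩⟩

/-- `H` is a subgraph of `G` that contains everything that happened before its events. -/
def DownClosed (G H : EventGraph ID C) : Prop :=
  H ⊆ G ∧ ∀ e ∈ H, events G e.parents ⊆ H

theorem DownClosed.happenedBefore {G H : EventGraph ID C} (h : DownClosed G H)
    {x e : Evt ID C} (he : e ∈ H) (hx : HappenedBefore G x e) : HappenedBefore H x e := by
  induction hx using Relation.TransGen.head_induction_on with
  | single h' =>
    exact .single ⟨h.2 e he ((mem_past (h.1 he)).2 (.single h')), he, h'.2.2⟩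
  | head h' _ ih =>
    have hc := ih.left_mem
    exact .head ⟨h.2 _ hc ((mem_past (h.1 hc)).2 (.single h')), hc, h'.2.2⟩ ih

theorem HappenedBefore.mono {G H : EventGraph ID C} (h : H ⊆ G) {x e : Evt ID C}
    (hx : HappenedBefore H x e) : HappenedBefore G x e :=
  Relation.TransGen.mono (p := IsParent G) (fun _ _ h' => ⟨h h'.1, h h'.2.1, h'.2.2⟩) _ _ hx

theorem DownClosed.past_eq {G H : EventGraph ID C} (h : DownClosed G H) {e : Evt ID C}
    (he : e ∈ H) : events H e.parents = events G e.parents := by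
  ext x
  rw [mem_past he, mem_past (h.1 he)]
  exact ⟨fun hx => hx.mono h.1, h.happenedBefore he⟩

theorem DownClosed.wellFormed {G H : EventGraph ID C} (h : DownClosed G H)
    (hG : WellFormed G) : WellFormed H where
  unique_id a ha b hb := hG.unique_id a (h.1 ha) b (h.1 hb)
  parents_mem e he p hp := by
    obtain ⟨a, ha, hae, rfl⟩ := hG.parents_mem e (h.1 he) p hp
    exact ⟨a, h.2 e he ((mem_past (h.1 he)).2 (.single ⟨ha, h.1 he, hp⟩)), hae, rfl⟩
  acyclic e he := hG.acyclic e (he.mono h.1)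

theorem DownClosed.valid {f : EventGraph ID C → Doc ID C} {G H : EventGraph ID C}
    (h : DownClosed G H) (hG : Valid f G) : Valid f H where
  unique_id := (h.wellFormed hG.wellFormed).unique_id
  parents_mem := (h.wellFormed hG.wellFormed).parents_mem
  acyclic := (h.wellFormed hG.wellFormed).acyclic
  inBounds e he := by
    rw [h.past_eq he]
    exact hG.inBounds e (h.1 he)

theorem DownClosed.refl (G : EventGraph ID C) : DownClosed G G :=
  ⟨subset_rfl, fun _ _ => events_subset _ _⟩

theorem downClosed_past {G : EventGraph ID C} {e : Evt ID C} (he : e ∈ G) :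
    DownClosed G (events G e.parents) :=
  ⟨events_subset _ _, fun _ hx => past_trans he hx⟩

theorem downClosed_insert_past {G : EventGraph ID C} {e : Evt ID C} (he : e ∈ G) :
    DownClosed G (insert e (events G e.parents)) := by
  refine ⟨Finset.insert_subset he (events_subset _ _), fun x hx => ?_⟩
  rcases Finset.mem_insert.1 hx with rfl | hx
  · exact Finset.subset_insert _ _
  · exact (past_trans he hx).trans (Finset.subset_insert _ _)

/-- The events of the version of a downward closed set `D` are those of `D`. -/
theorem WellFormed.events_version {G D : EventGraph ID C} (hG : WellFormed G)
    (hD : DownClosed G D) : events G (version D) = D := by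
  ext x
  simp only [events, version, Finset.mem_filter, Finset.mem_image]
  constructor
  · rintro ⟨hx, ⟨y, ⟨hy, -⟩, hxy⟩ | ⟨b, hb, ⟨y, ⟨hy, -⟩, hyb⟩, h⟩⟩
    · rwa [← hG.unique_id _ (hD.1 hy) _ hx hxy]
    · rw [← hG.unique_id _ (hD.1 hy) _ hb hyb] at h
      exact hD.2 _ hy ((mem_past (hD.1 hy)).2 h)
  · intro hx
    -- an event above `x` with the largest past is maximal
    obtain ⟨y, hy, hmax⟩ := Finset.exists_max_image
      (D.filter fun y => y = x ∨ HappenedBefore G x y) (fun y => (events G y.parents).card)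
      ⟨x, by simp [hx]⟩
    rw [Finset.mem_filter] at hy
    refine ⟨hD.1 hx, ?_⟩
    have hyv : ∀ b ∈ D, ¬ HappenedBefore D y b := by
      intro b hb hyb
      have hyb := hyb.mono hD.1
      have h1 := hG.card_past_lt (hD.1 hb) ((mem_past (hD.1 hb)).2 hyb)
      refine absurd (hmax b ?_) (not_le.2 h1)
      rw [Finset.mem_filter]
      refine ⟨hb, Or.inr ?_⟩
      rcases hy.2 with rfl | h
      · exact hyb
      · exact h.trans hyb
    rcases hy.2 with rfl | h
    · exact Or.inl ⟨y, ⟨hx, hyv⟩, rfl⟩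
    · exact Or.inr ⟨y, hD.1 hy.1, ⟨y, ⟨hy.1, hyv⟩, rfl⟩, h⟩

/-! ### Topologically sorted lists -/

/-- `es` lists events of `G`, each once and none from `S`, such that the past `P e` of every event
`e` is contained in `S` and the events listed before `e`. -/
def TopFrom (G : EventGraph ID C) (P : Evt ID C → EventGraph ID C) :
    Set (Evt ID C) → List (Evt ID C) → Prop
  | _, [] => True
  | S, e :: es => e ∈ G ∧ e ∉ S ∧ (∀ x ∈ P e, x ∈ S) ∧ TopFrom G P (insert e S) es

section TopFrom

variable {G : EventGraph ID C} {P : Evt ID C → EventGraph ID C}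

theorem topFrom_append {S : Set (Evt ID C)} {u v : List (Evt ID C)} :
    TopFrom G P S (u ++ v) ↔ TopFrom G P S u ∧ TopFrom G P (S ∪ {x | x ∈ u}) v := by
  induction u generalizing S with
  | nil => simp [TopFrom]
  | cons a u ih =>
    have : insert a S ∪ {x | x ∈ u} = S ∪ {x | x ∈ a :: u} := by
      ext x; simp; tauto
    simp only [List.cons_append, TopFrom, ih, this]
    tauto

theorem TopFrom.mem {S : Set (Evt ID C)} {es : List (Evt ID C)} (h : TopFrom G P S es)
    {x : Evt ID C} (hx : x ∈ es) : x ∈ G ∧ x ∉ S := by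
  induction es generalizing S with
  | nil => simp at hx
  | cons a es ih =>
    rcases List.mem_cons.1 hx with rfl | hx
    · exact ⟨h.1, h.2.1⟩
    · have := ih h.2.2.2 hx
      exact ⟨this.1, fun hS => this.2 (Set.mem_insert_of_mem _ hS)⟩

theorem TopFrom.nodup {S : Set (Evt ID C)} {es : List (Evt ID C)} (h : TopFrom G P S es) :
    es.Nodup := by
  induction es generalizing S with
  | nil => simp
  | cons a es ih =>
    exact List.nodup_cons.2 ⟨fun ha => (h.2.2.2.mem ha).2 (Set.mem_insert _ _), ih h.2.2.2⟩

theorem TopFrom.past_subset {es : List (Evt ID C)} (h : TopFrom G P ∅ es)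
    {e : Evt ID C} (he : e ∈ es) {x : Evt ID C} (hx : x ∈ P e) : x ∈ es := by
  obtain ⟨u, v, rfl⟩ := List.append_of_mem he
  have := (topFrom_append.1 h).2.2.2.1 x hx
  simp only [Set.empty_union, Set.mem_ofPred_eq] at this
  exact List.mem_append_left _ this

theorem TopFrom.mono_filter {A B : Set (Evt ID C)} {es : List (Evt ID C)}
    (h : TopFrom G P A es) (hAB : A ⊆ B) :
    TopFrom G P B (es.filter fun x => decide (x ∉ B)) := by
  induction es generalizing A B with
  | nil => simp [TopFrom]
  | cons a es ih =>
    by_cases ha : a ∈ B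
    · simp only [ha, not_true_eq_false, decide_false, Bool.false_eq_true, not_false_eq_true,
        List.filter_cons_of_neg]
      exact ih h.2.2.2 (Set.insert_subset ha hAB)
    · have h1 : (es.filter fun x => decide (x ∉ B)) =
          es.filter fun x => decide (x ∉ insert a B) := by
        refine List.filter_congr fun x hx => ?_
        have : x ≠ a := fun hxa => (h.2.2.2.mem hx).2 (hxa ▸ Set.mem_insert _ _)
        simp [this]
      simp only [ha, not_false_eq_true, decide_true, List.filter_cons_of_pos]
      rw [h1]
      refine ⟨h.1, ha, fun x hx => hAB (h.2.2.1 x hx), ?_⟩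
      convert ih h.2.2.2 (Set.insert_subset_insert hAB)

/-- A topologically sorted list is completed by the missing events in the order in which another
such list has them. -/
theorem TopFrom.append_filter {u es : List (Evt ID C)} (hu : TopFrom G P ∅ u)
    (h : TopFrom G P ∅ es) : TopFrom G P ∅ (u ++ es.filter fun x => decide (x ∉ u)) :=
  topFrom_append.2 ⟨hu, by simpa using h.mono_filter (B := {x | x ∈ u}) (by simp)⟩

theorem topFrom_swap {u w : List (Evt ID C)} {a b : Evt ID C}
    (h : TopFrom G P ∅ (u ++ a :: b :: w)) (hab : a ∉ P b) :
    TopFrom G P ∅ (u ++ b :: a :: w) := by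
  rw [topFrom_append] at h ⊢
  obtain ⟨hu, h1, h2, h3, h4, h5, h6, h7⟩ := h
  refine ⟨hu, h4, fun h => h5 (Set.mem_insert_of_mem _ h), fun x hx => ?_, h1, ?_, ?_, ?_⟩
  · rcases h6 x hx with rfl | h
    · exact absurd hx hab
    · exact h
  · rintro (rfl | h)
    · exact h5 (Set.mem_insert _ _)
    · exact h2 h
  · exact fun x hx => Set.mem_insert_of_mem _ (h3 x hx)
  · rwa [Set.insert_comm]

end TopFrom

theorem WellFormed.exists_isTopSort {G : EventGraph ID C} (hG : WellFormed G) :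
    ∃ es, IsTopSort G es := by
  let r : Evt ID C → Evt ID C → Prop := fun a b =>
    (events G a.parents).card ≤ (events G b.parents).card
  have : Std.Total r := ⟨fun a b => le_total _ _⟩
  have : IsTrans _ r := ⟨fun a b c h h' => le_trans (α := ℕ) h h'⟩
  refine ⟨G.toList.insertionSort r, ?_, ?_, ?_⟩
  · exact (List.perm_insertionSort r _).nodup_iff.2 G.nodup_toList
  · intro e
    rw [(List.perm_insertionSort r _).mem_iff, Finset.mem_toList]
  · refine (List.pairwise_insertionSort r _).imp fun {a b} hab h => ?_
    exact absurd (hG.card_past_lt h.right_mem ((mem_past h.right_mem).2 h)) (not_lt.2 hab)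

theorem IsTopSort.topFrom {G : EventGraph ID C} (hG : WellFormed G) {es : List (Evt ID C)}
    (hes : IsTopSort G es) :
    TopFrom G (fun e => events G e.parents) ∅ es := by
  suffices H : ∀ u v, es = u ++ v →
      TopFrom G (fun e => events G e.parents) {x | x ∈ u} v by
    simpa using H [] es rfl
  intro u v huv
  induction v generalizing u with
  | nil => trivial
  | cons a v ih =>
    subst huv
    have haG : a ∈ G := (hes.mem_iff a).1 (by simp)
    refine ⟨haG, ?_, fun x hx => ?_, ?_⟩
    · have := hes.nodup
      rw [List.nodup_append] at this
      exact fun h => this.2.2 a h a (by simp) rfl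
    · have hx' := (mem_past haG).1 hx
      have hmem := (hes.mem_iff x).2 hx'.left_mem
      have hc := hes.causal
      rw [List.pairwise_append, List.pairwise_cons] at hc
      rcases List.mem_append.1 hmem with h | h
      · exact h
      · rcases List.mem_cons.1 h with rfl | h
        · exact absurd hx' (hG.acyclic x)
        · exact absurd hx' (hc.2.1.1 x h)
    · have := ih (u ++ [a]) (by simp)
      convert this using 1
      ext x; simp [or_comm]

theorem TopFrom.isTopSort {G : EventGraph ID C} {es : List (Evt ID C)}
    (h : TopFrom G (fun e => events G e.parents) ∅ es) (hmem : ∀ e ∈ G, e ∈ es) :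
    IsTopSort G es := by
  refine ⟨h.nodup, fun e => ⟨fun he => (h.mem he).1, hmem e⟩, ?_⟩
  suffices H : ∀ S, TopFrom G (fun e => events G e.parents) S es →
      es.Pairwise fun a b => ¬ HappenedBefore G b a from H ∅ h
  clear h hmem
  intro S h
  induction es generalizing S with
  | nil => simp
  | cons a es ih =>
    refine List.pairwise_cons.2 ⟨fun b hb hba => ?_, ih _ h.2.2.2⟩
    exact (h.2.2.2.mem hb).2 (Set.mem_insert_of_mem _ (h.2.2.1 b ((mem_past h.1).2 hba)))

/-! ### Representing a list by records and placeholders -/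

section Split

variable {α : Type*}

/-- Split a list directly after its `i`th element that satisfies `p`. -/
def splitNth (p : α → Bool) : ℕ → List α → List α × List α
  | 0, l => ([], l)
  | _ + 1, [] => ([], [])
  | i + 1, x :: l =>
      let q := splitNth p (if p x then i else i + 1) l
      (x :: q.1, q.2)

theorem splitNth_append (p : α → Bool) (i : ℕ) (l : List α) :
    (splitNth p i l).1 ++ (splitNth p i l).2 = l := by
  induction l generalizing i with
  | nil => cases i <;> simp [splitNth]
  | cons a l ih =>
    cases i with
    | zero => simp [splitNth]
    | succ i => simp [splitNth, ih]

theorem countP_splitNth (p : α → Bool) {i : ℕ} {l : List α} (h : i ≤ l.countP p) :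
    (splitNth p i l).1.countP p = i := by
  induction l generalizing i with
  | nil => simp at h; subst h; simp [splitNth]
  | cons a l ih =>
    cases i with
    | zero => simp [splitNth]
    | succ i =>
      rw [List.countP_cons] at h
      by_cases hp : p a
      · simp only [splitNth, hp, if_true, List.countP_cons] at h ⊢
        rw [ih (by omega)]
      · simp only [splitNth, hp, List.countP_cons] at h ⊢
        rw [if_neg (by simp), ih (by simpa using h)]
        simp

/-- The part in front of the split point is empty or ends with an element that satisfies `p`. -/
theorem splitNth_last (p : α → Bool) {i : ℕ} {l : List α} (h : i ≤ l.countP p) :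
    (i = 0 ∧ (splitNth p i l).1 = []) ∨
      ∃ A x, (splitNth p i l).1 = A ++ [x] ∧ p x = true := by
  induction l generalizing i with
  | nil => simp at h; subst h; simp [splitNth]
  | cons a l ih =>
    cases i with
    | zero => simp [splitNth]
    | succ i =>
      right
      rw [List.countP_cons] at h
      by_cases hp : p a
      · simp only [hp, if_true] at h
        rcases ih (i := i) (by omega) with ⟨h0, h1⟩ | ⟨A, x, h1, h2⟩
        · exact ⟨[], a, by simp [splitNth, hp, h1], hp⟩
        · exact ⟨a :: A, x, by simp [splitNth, hp, h1], h2⟩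
      · simp only [hp] at h
        rcases ih (i := i + 1) (by simpa using h) with ⟨h0, h1⟩ | ⟨A, x, h1, h2⟩
        · omega
        · exact ⟨a :: A, x, by simp [splitNth, hp, h1], h2⟩

theorem splitNth_of_last (p : α → Bool) {A B : List α} {x : α} (hx : p x = true) :
    splitNth p ((A ++ [x]).countP p) (A ++ [x] ++ B) = (A ++ [x], B) := by
  induction A with
  | nil => simp [splitNth, hx]
  | cons a A ih =>
    have hpos : ∃ m, (A ++ [x]).countP p = m + 1 := ⟨A.countP p, by simp [hx]⟩
    obtain ⟨m, hm⟩ := hpos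
    simp only [List.cons_append, List.countP_cons]
    by_cases ha : p a
    · simp only [ha, if_true, splitNth]
      rw [ih]
    · simp only [ha]
      rw [if_neg (by simp), add_zero, hm]
      simp only [splitNth, ha]
      rw [if_neg (by simp), ← hm, ih]

theorem exists_split_of_lt_countP (p : α → Bool) {k : ℕ} {l : List α} (h : k < l.countP p) :
    ∃ A x B, l = A ++ x :: B ∧ A.countP p = k ∧ p x = true ∧ (l.filter p)[k]? = some x := by
  induction l generalizing k with
  | nil => simp at h
  | cons a l ih =>
    by_cases ha : p a
    · cases k with
      | zero => exact ⟨[], a, l, by simp [ha]⟩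
      | succ k =>
        rw [List.countP_cons_of_pos ha] at h
        obtain ⟨A, x, B, rfl, h2, h3, h4⟩ := ih (k := k) (by omega)
        exact ⟨a :: A, x, B, by simp, by simp [ha, h2], h3, by
          rw [List.filter_cons_of_pos ha]; simpa using h4⟩
    · rw [List.countP_cons_of_neg ha] at h
      obtain ⟨A, x, B, rfl, h2, h3, h4⟩ := ih h
      exact ⟨a :: A, x, B, by simp, by simp [ha, h2], h3, by
        rw [List.filter_cons_of_neg ha]; exact h4⟩

/-- From the split point to the next element that satisfies `p`, there are only elements that do
not. -/
theorem splitNth_append_cons (p : α → Bool) {A B : List α} {x : α} :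
    ∃ A', A = (splitNth p (A.countP p) (A ++ x :: B)).1 ++ A' ∧
      (splitNth p (A.countP p) (A ++ x :: B)).2 = A' ++ x :: B ∧ ∀ y ∈ A', p y = false := by
  induction A with
  | nil => exact ⟨[], by simp [splitNth]⟩
  | cons a A ih =>
    obtain ⟨A', h1, h2, h3⟩ := ih
    by_cases ha : p a = true
    · refine ⟨A', ?_, ?_, h3⟩
      · rw [List.countP_cons_of_pos ha]
        simp only [List.cons_append, splitNth, ha, if_true]
        rw [← h1]
      · rw [List.countP_cons_of_pos ha]
        simp only [List.cons_append, splitNth, ha, if_true]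
        exact h2
    · rw [List.countP_cons_of_neg ha]
      cases hm : A.countP p with
      | zero =>
        refine ⟨a :: A, by simp [splitNth], by simp [splitNth], fun y hy => ?_⟩
        rcases List.mem_cons.1 hy with rfl | hy
        · simpa using ha
        · simpa using List.countP_eq_zero.1 hm y hy
      | succ m =>
        rw [hm] at h1 h2
        refine ⟨A', ?_, ?_, h3⟩
        · simp only [List.cons_append, splitNth, ha]
          rw [if_neg (by simp), ← h1]
        · simp only [List.cons_append, splitNth, ha]
          rw [if_neg (by simp)]
          exact h2

/-- The split point depends only on the part in front of it. -/
theorem splitNth_prefix (p : α → Bool) {i : ℕ} {l : List α} (h : i ≤ l.countP p)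
    (Y : List α) : splitNth p i ((splitNth p i l).1 ++ Y) = ((splitNth p i l).1, Y) := by
  rcases splitNth_last p h with ⟨rfl, h1⟩ | ⟨A, x, h1, hx⟩
  · simp [splitNth]
  · have hc := countP_splitNth p h
    rw [h1] at hc ⊢
    rw [← hc]
    exact splitNth_of_last p hx

end Split

/-- `Rep Dead Alive M o l s`: the sequence `s` of records and placeholders represents the list
`l`. Elements that satisfy `Dead` may be missing in `s`, a placeholder stands for elements that
satisfy `Alive`, and a record `r` stands for an element `x` with `M x r`. If `o` holds, then `s`
may end with a placeholder of unbounded length. -/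
inductive Rep {α : Type*} (Dead Alive : α → Prop) (M : α → Record ID C → Prop) (o : Prop) :
    List α → List (Item ID C) → Prop
  | nil : Rep Dead Alive M o [] []
  | top : o → Rep Dead Alive M o [] [.placeholder ⊤]
  | dead {x l s} : Dead x → Rep Dead Alive M o l s → Rep Dead Alive M o (x :: l) s
  | one {x l s} : Alive x → Rep Dead Alive M o l s →
      Rep Dead Alive M o (x :: l) (.placeholder 1 :: s)
  | succ {x l s} {n : ℕ∞} : Alive x → Rep Dead Alive M o l (.placeholder n :: s) →
      Rep Dead Alive M o (x :: l) (.placeholder (n + 1) :: s)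
  | record {x l r s} : M x r → Rep Dead Alive M o l s →
      Rep Dead Alive M o (x :: l) (.record r :: s)

namespace Rep

variable {α : Type*} {Dead Alive : α → Prop} {M : α → Record ID C → Prop} {o : Prop}
  {l : List α} {s : List (Item ID C)}

theorem mono {Dead' Alive' : α → Prop} {M' : α → Record ID C → Prop} {o' : Prop}
    (f : Item ID C → Item ID C) (hf : ∀ n, f (.placeholder n) = .placeholder n)
    (h : Rep Dead Alive M o l s) (ho : o → o')
    (hD : ∀ x ∈ l, Dead x → Dead' x) (hA : ∀ x ∈ l, Alive x → Alive' x)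
    (hM : ∀ x ∈ l, ∀ r, M x r → ∃ r', f (.record r) = .record r' ∧ M' x r') :
    Rep Dead' Alive' M' o' l (s.map f) := by
  induction h with
  | nil => exact .nil
  | top h => simpa [hf] using Rep.top (ho h)
  | dead hx _ ih =>
    exact .dead (hD _ (by simp) hx) (ih (fun y hy => hD y (by simp [hy]))
      (fun y hy => hA y (by simp [hy])) fun y hy => hM y (by simp [hy]))
  | one hx _ ih =>
    have := ih (fun y hy => hD y (by simp [hy]))
      (fun y hy => hA y (by simp [hy])) fun y hy => hM y (by simp [hy])
    simp only [List.map_cons, hf] at this ⊢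
    exact .one (hA _ (by simp) hx) this
  | succ hx _ ih =>
    have := ih (fun y hy => hD y (by simp [hy]))
      (fun y hy => hA y (by simp [hy])) fun y hy => hM y (by simp [hy])
    simp only [List.map_cons, hf] at this ⊢
    exact .succ (hA _ (by simp) hx) this
  | record hx _ ih =>
    obtain ⟨r', hr, hM'⟩ := hM _ (by simp) _ hx
    simp only [List.map_cons, hr]
    exact .record hM' (ih (fun y hy => hD y (by simp [hy]))
      (fun y hy => hA y (by simp [hy])) fun y hy => hM y (by simp [hy]))

theorem weaken {Dead' Alive' : α → Prop} {M' : α → Record ID C → Prop} {o' : Prop}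
    (h : Rep Dead Alive M o l s) (ho : o → o')
    (hD : ∀ x ∈ l, Dead x → Dead' x) (hA : ∀ x ∈ l, Alive x → Alive' x)
    (hM : ∀ x ∈ l, ∀ r, M x r → M' x r) : Rep Dead' Alive' M' o' l s := by
  simpa using h.mono id (fun _ => rfl) ho hD hA fun x hx r hr => ⟨r, rfl, hM x hx r hr⟩

theorem append {l' : List α} {s' : List (Item ID C)} (h : Rep Dead Alive M False l s)
    (h' : Rep Dead Alive M o l' s') : Rep Dead Alive M o (l ++ l') (s ++ s') := by
  induction h with
  | nil => exact h'
  | top h => exact h.elim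
  | dead hx _ ih => exact .dead hx ih
  | one hx _ ih => exact .one hx ih
  | succ hx _ ih => exact .succ hx ih
  | record hx _ ih => exact .record hx ih

theorem placeholder_ne_zero {n : ℕ∞} (h : Rep Dead Alive M o l (.placeholder n :: s)) :
    n ≠ 0 := by
  generalize ht : Item.placeholder n :: s = t at h
  induction h with
  | nil => cases ht
  | top h => simp at ht; simp [ht.1]
  | dead hx _ ih => exact ih ht
  | one => simp at ht; simp [ht.1]
  | succ => simp at ht; simp [ht.1]
  | record => cases ht

theorem all_top (ho : o) (h : ∀ x ∈ l, Dead x ∨ Alive x) :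
    Rep Dead Alive M o l [.placeholder ⊤] := by
  induction l with
  | nil => exact .top ho
  | cons a l ih =>
    have := ih fun x hx => h x (by simp [hx])
    rcases h a (by simp) with h | h
    · exact .dead h this
    · simpa using Rep.succ h this

/-- Splitting at a position of the prepare version splits the represented list. -/
theorem split {p : α → Bool} (h : Rep Dead Alive M o l s)
    (hD : ∀ x ∈ l, Dead x → p x = false) (hA : ∀ x ∈ l, Alive x → p x = true)
    (hM : ∀ x ∈ l, ∀ r, M x r → (r.sp = 1 ↔ p x = true)) {i : ℕ} (hi : i ≤ l.countP p) :
    Rep Dead Alive M False (splitNth p i l).1 (splitPrep i s).1 ∧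
      Rep Dead Alive M o (splitNth p i l).2 (splitPrep i s).2 := by
  induction h generalizing i with
  | nil => simp at hi; subst hi; exact ⟨.nil, .nil⟩
  | top h => simp at hi; subst hi; exact ⟨.nil, .top h⟩
  | @dead x l s hx hr ih =>
    cases i with
    | zero => simpa only [splitNth, splitPrep] using ⟨.nil, .dead hx hr⟩
    | succ i =>
      have hp := hD x (by simp) hx
      have := ih (fun y hy => hD y (by simp [hy])) (fun y hy => hA y (by simp [hy]))
        (fun y hy => hM y (by simp [hy])) (i := i + 1) (by simpa [hp] using hi)
      simp only [splitNth, hp]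
      exact ⟨.dead hx this.1, this.2⟩
  | @one x l s hx hr ih =>
    cases i with
    | zero => exact ⟨.nil, .one hx hr⟩
    | succ i =>
      have hp := hA x (by simp) hx
      have := ih (fun y hy => hD y (by simp [hy])) (fun y hy => hA y (by simp [hy]))
        (fun y hy => hM y (by simp [hy])) (i := i) (by simpa [hp] using hi)
      have h1 : ¬ ((i + 1 : ℕ) : ℕ∞) < 1 := by norm_cast; omega
      simp only [splitNth, splitPrep, hp, if_true, if_neg h1, ENat.toNat_one,
        Nat.add_sub_cancel]
      exact ⟨.one hx this.1, this.2⟩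
  | @succ x l s n hx hr ih =>
    cases i with
    | zero => exact ⟨.nil, .succ hx hr⟩
    | succ i =>
      have hp := hA x (by simp) hx
      have H := ih (fun y hy => hD y (by simp [hy])) (fun y hy => hA y (by simp [hy]))
        (fun y hy => hM y (by simp [hy])) (i := i) (by simpa [hp] using hi)
      simp only [splitNth, hp, if_true]
      cases i with
      | zero =>
        simp only [splitNth, splitPrep] at H ⊢
        have h0 := hr.placeholder_ne_zero
        rw [if_pos (by
          cases n using ENat.recTopCoe with
          | top => simp
          | coe n => norm_cast at h0 ⊢; omega)]
        refine ⟨by simpa using Rep.one hx .nil, ?_⟩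
        have : n + 1 - ((0 + 1 : ℕ) : ℕ∞) = n := by
          cases n using ENat.recTopCoe with
          | top => rfl
          | coe n => norm_cast
        rw [this]
        exact hr
      | succ j =>
        simp only [splitPrep] at H ⊢
        by_cases hn : ((j + 1 : ℕ) : ℕ∞) < n
        · have hn' : ((j + 1 + 1 : ℕ) : ℕ∞) < n + 1 := by
            cases n using ENat.recTopCoe with
            | top => exact WithTop.coe_lt_top _
            | coe n => norm_cast at hn ⊢; omega
          rw [if_pos hn] at H
          rw [if_pos hn']
          refine ⟨?_, ?_⟩
          · have := Rep.succ hx H.1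
            simpa using this
          · have : n + 1 - ((j + 1 + 1 : ℕ) : ℕ∞) = n - ((j + 1 : ℕ) : ℕ∞) := by
              cases n using ENat.recTopCoe with
              | top => rfl
              | coe n => norm_cast; omega
            rw [this]; exact H.2
        · have hn' : ¬ ((j + 1 + 1 : ℕ) : ℕ∞) < n + 1 := by
            cases n using ENat.recTopCoe with
            | top => exact absurd (WithTop.coe_lt_top _) hn
            | coe n => norm_cast at hn ⊢; omega
          rw [if_neg hn] at H
          rw [if_neg hn']
          have : j + 1 + 1 - (n + 1).toNat = j + 1 - n.toNat := by
            cases n using ENat.recTopCoe with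
            | top => exact absurd (WithTop.coe_lt_top _) hn
            | coe n =>
              have : (n : ℕ∞) + 1 = ((n + 1 : ℕ) : ℕ∞) := by norm_cast
              rw [this, ENat.toNat_natCast, ENat.toNat_natCast]
              omega
          rw [this]
          exact ⟨.succ hx H.1, H.2⟩
  | @record x l r s hx hr ih =>
    cases i with
    | zero => exact ⟨.nil, .record hx hr⟩
    | succ i =>
      have hp := hM x (by simp) r hx
      have := ih (fun y hy => hD y (by simp [hy])) (fun y hy => hA y (by simp [hy]))
        (fun y hy => hM y (by simp [hy])) (i := if p x = true then i else i + 1) (by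
          rw [List.countP_cons] at hi
          split_ifs with h
          · simp [h] at hi; exact hi
          · simp [h] at hi; exact hi)
      simp only [splitNth, splitPrep, hp]
      exact ⟨.record hx this.1, this.2⟩

/-- A run of `NotInsertedYet` records does not start with an element for which all records have
been inserted. -/
theorem notInsertedRun_eq_nil {S : α → Prop} (h : Rep Dead Alive M o l s)
    (hM : ∀ x ∈ l, ∀ r, M x r → S x → r.sp ≠ 0)
    (hc : l.IsChain fun x y => Dead x → S y) (hl : ∀ x ∈ l.head?, S x) :
    notInsertedRun s = [] := by
  induction h with
  | nil => rfl
  | top => rfl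
  | @dead x l s hx _ ih =>
    refine ih (fun y hy => hM y (by simp [hy])) hc.tail fun y hy => ?_
    cases l with
    | nil => simp at hy
    | cons z l =>
      simp at hy; subst hy
      exact (List.isChain_cons_cons.1 hc).1 hx
  | one => rfl
  | succ => rfl
  | record hx => simp [notInsertedRun, hM _ (by simp) _ hx (hl _ (by simp))]

/-- The run of `NotInsertedYet` records consists of the records of the corresponding run of the
represented list. It cannot extend over missing elements, because these are only followed by
elements that satisfy `S`. -/
theorem run {S : α → Prop} {q : α → Bool} {β : Type*} (f : Record ID C → β) (g : α → β)
    (h : Rep Dead Alive M o l s) (hD : ∀ x ∈ l, Dead x → q x = false)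
    (hA : ∀ x ∈ l, Alive x → q x = false)
    (hM : ∀ x ∈ l, ∀ r, M x r → (r.sp = 0 ↔ q x = true) ∧ (q x = true → f r = g x))
    (hS : ∀ x ∈ l, S x → q x = false) (hc : l.IsChain fun x y => Dead x → S y) :
    (notInsertedRun s).map f = (l.takeWhile q).map g ∧
      ∀ k ≤ (l.takeWhile q).length, Rep Dead Alive M False (l.take k) (s.take k) ∧
        Rep Dead Alive M o (l.drop k) (s.drop k) := by
  induction h with
  | nil => simpa [notInsertedRun] using ⟨Rep.nil, Rep.nil⟩
  | top h => simpa [notInsertedRun] using ⟨Rep.nil, Rep.top h⟩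
  | @dead x l s hx hr ih =>
    have hq := hD x (by simp) hx
    have : notInsertedRun s = [] := by
      refine hr.notInsertedRun_eq_nil (S := S) (fun x hx r hr hSx h0 => ?_) hc.tail fun y hy => ?_
      · have := hS x (by simp [hx]) hSx
        rw [((hM x (by simp [hx]) r hr).1.1 h0)] at this
        cases this
      · cases l with
        | nil => simp at hy
        | cons z l =>
          simp at hy; subst hy
          exact (List.isChain_cons_cons.1 hc).1 hx
    simpa [this, hq] using ⟨Rep.nil, Rep.dead hx hr⟩
  | @one x l s hx hr ih =>
    have hq := hA x (by simp) hx
    simpa [notInsertedRun, hq] using ⟨Rep.nil, Rep.one hx hr⟩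
  | @succ x l s n hx hr ih =>
    have hq := hA x (by simp) hx
    simpa [notInsertedRun, hq] using ⟨Rep.nil, Rep.succ hx hr⟩
  | @record x l r s hx hr ih =>
    obtain ⟨h0, hfg⟩ := hM x (by simp) r hx
    by_cases hq : q x = true
    · obtain ⟨ih1, ih2⟩ := ih (fun y hy => hD y (by simp [hy])) (fun y hy => hA y (by simp [hy]))
        (fun y hy => hM y (by simp [hy])) (fun y hy => hS y (by simp [hy])) hc.tail
      refine ⟨by simp [notInsertedRun, h0.2 hq, hq, ih1, hfg hq], fun k hk => ?_⟩
      cases k with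
      | zero => exact ⟨.nil, .record hx hr⟩
      | succ k =>
        have := ih2 k (by simpa [hq] using hk)
        exact ⟨.record hx this.1, this.2⟩
    · have h0' : r.sp ≠ 0 := fun h => hq (h0.1 h)
      simpa [notInsertedRun, h0', hq] using ⟨Rep.nil, Rep.record hx hr⟩

/-- The first entry that is visible in the prepare version represents the first element that
satisfies `p`. -/
theorem dropWhile {p : α → Bool} {A B : List α} {x : α} (h : Rep Dead Alive M o (A ++ x :: B) s)
    (hD : ∀ y ∈ A ++ x :: B, Dead y → p y = false)
    (hA : ∀ y ∈ A ++ x :: B, Alive y → p y = true)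
    (hM : ∀ y ∈ A ++ x :: B, ∀ r, M y r → (r.sp = 1 ↔ p y = true))
    (hpA : ∀ y ∈ A, p y = false) (hpx : p x = true) :
    Rep Dead Alive M False A (s.takeWhile fun z => !z.prepVisible) ∧
      ((∃ r rest, (s.dropWhile fun z => !z.prepVisible) = .record r :: rest ∧ M x r ∧
          Rep Dead Alive M o B rest) ∨
        ∃ n rest, (s.dropWhile fun z => !z.prepVisible) = .placeholder n :: rest ∧ Alive x ∧
          Rep Dead Alive M o B ((if n - 1 = 0 then [] else [.placeholder (n - 1)]) ++ rest)) := by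
  generalize hl : A ++ x :: B = l at h
  induction h generalizing A with
  | nil => simp at hl
  | top => simp at hl
  | @dead y l s hy hr ih =>
    cases A with
    | nil =>
      simp at hl
      have := hD x (by simp) (hl.1 ▸ hy)
      rw [hpx] at this; cases this
    | cons a A =>
      simp only [List.cons_append, List.cons.injEq] at hl
      obtain ⟨rfl, hl⟩ := hl
      have := ih (A := A) (fun y hy => hD y (List.mem_cons_of_mem _ hy))
        (fun y hy => hA y (List.mem_cons_of_mem _ hy))
        (fun y hy => hM y (List.mem_cons_of_mem _ hy)) (fun y hy => hpA y (by simp [hy])) hl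
      exact ⟨.dead hy this.1, this.2⟩
  | @one y l s hy hr ih =>
    cases A with
    | nil =>
      simp only [List.nil_append, List.cons.injEq] at hl
      obtain ⟨rfl, rfl⟩ := hl
      simp only [List.takeWhile, List.dropWhile, Item.prepVisible]
      exact ⟨by simpa using Rep.nil, Or.inr ⟨1, s, by simp, hy, by simpa using hr⟩⟩
    | cons a A =>
      simp only [List.cons_append, List.cons.injEq] at hl
      have := hA a (by simp) (hl.1 ▸ hy)
      rw [hpA a (by simp)] at this; cases this
  | @succ y l s n hy hr ih =>
    cases A with
    | nil =>
      simp only [List.nil_append, List.cons.injEq] at hl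
      obtain ⟨rfl, rfl⟩ := hl
      simp only [List.takeWhile, List.dropWhile, Item.prepVisible]
      have hn : n + 1 - 1 = n := by
        cases n using ENat.recTopCoe with
        | top => rfl
        | coe n => norm_cast
      exact ⟨by simpa using Rep.nil, Or.inr ⟨n + 1, s, by simp, hy, by
        rw [hn, if_neg hr.placeholder_ne_zero]; exact hr⟩⟩
    | cons a A =>
      simp only [List.cons_append, List.cons.injEq] at hl
      have := hA a (by simp) (hl.1 ▸ hy)
      rw [hpA a (by simp)] at this; cases this
  | @record y l r s hy hr ih =>
    cases A with
    | nil =>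
      simp only [List.nil_append, List.cons.injEq] at hl
      obtain ⟨rfl, rfl⟩ := hl
      have := (hM x (by simp) r hy).2 hpx
      simp only [List.takeWhile, List.dropWhile, Item.prepVisible, this]
      exact ⟨by simpa using Rep.nil, Or.inl ⟨r, s, by simp, hy, hr⟩⟩
    | cons a A =>
      simp only [List.cons_append, List.cons.injEq] at hl
      obtain ⟨rfl, hl⟩ := hl
      have h1 : r.sp ≠ 1 := fun h => by
        have := (hM a (by simp) r hy).1 h
        rw [hpA a (by simp)] at this; cases this
      have := ih (A := A) (fun y hy => hD y (List.mem_cons_of_mem _ hy))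
        (fun y hy => hA y (List.mem_cons_of_mem _ hy))
        (fun y hy => hM y (List.mem_cons_of_mem _ hy)) (fun y hy => hpA y (by simp [hy])) hl
      simp only [List.takeWhile, List.dropWhile, Item.prepVisible, h1, decide_false, Bool.not_false]
      exact ⟨.record hy this.1, this.2⟩

theorem effIndex_eq {v : α → Bool} (h : Rep Dead Alive M False l s)
    (hD : ∀ x ∈ l, Dead x → v x = false) (hA : ∀ x ∈ l, Alive x → v x = true)
    (hM : ∀ x ∈ l, ∀ r, M x r → r.deleted = !v x) : effIndex s = l.countP v := by
  suffices H : (s.map Item.effLen).sum = (l.countP v : ℕ) by simp [effIndex, H]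
  generalize ho : False = o at h
  induction h with
  | nil => simp
  | top h => exact (ho ▸ h : False).elim
  | dead hx _ ih =>
    rw [ih (fun y hy => hD y (by simp [hy])) (fun y hy => hA y (by simp [hy]))
      (fun y hy => hM y (by simp [hy]))]
    simp [hD _ (by simp) hx]
  | one hx _ ih =>
    rw [List.map_cons, List.sum_cons, ih (fun y hy => hD y (by simp [hy]))
      (fun y hy => hA y (by simp [hy])) (fun y hy => hM y (by simp [hy]))]
    simp [hA _ (by simp) hx, Item.effLen, add_comm]
  | succ hx _ ih =>
    have := ih (fun y hy => hD y (by simp [hy]))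
      (fun y hy => hA y (by simp [hy])) (fun y hy => hM y (by simp [hy]))
    rw [List.map_cons, List.sum_cons] at this ⊢
    simp only [Item.effLen] at this ⊢
    rw [add_right_comm, this]
    simp [hA _ (by simp) hx]
  | record hx _ ih =>
    rw [List.map_cons, List.sum_cons, ih (fun y hy => hD y (by simp [hy]))
      (fun y hy => hA y (by simp [hy])) (fun y hy => hM y (by simp [hy]))]
    have := hM _ (by simp) _ hx
    simp only [Item.effLen, this, List.countP_cons]
    cases v _ <;> simp [add_comm]

end Rep

/-! ### The abstract replay -/

section Model

variable (R : IntegrationRule ID C) (P : Evt ID C → EventGraph ID C) (T : Evt ID C → Option ID)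

/-- The number of events of `Q` that insert or delete the character inserted by `x`, where `T d`
is the ID of the character that `d` inserts or deletes. This is the state of that character in
the version of `Q`, encoded as in `Record.sp`. -/
def charState (Q : EventGraph ID C) (x : Evt ID C) : ℕ :=
  (Q.filter fun d => T d = some x.id).card

/-- Is the character inserted by `x` visible to an event with past `Q`? -/
def visibleIn (Q : EventGraph ID C) (x : Evt ID C) : Bool := decide (charState T Q x = 1)

/-- Did one of the events `D` delete the character inserted by `x`? The event `x` is excluded because
an insertion has itself as its target. -/
def DeletedIn (D : List (Evt ID C)) (x : Evt ID C) : Prop := ∃ d ∈ D, d ≠ x ∧ T d = some x.id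

/-- The abstract effect of an event on the sequence of all insertions, including those of deleted
characters. -/
def integrate (l : List (Evt ID C)) (e : Evt ID C) : List (Evt ID C) :=
  match e.op with
  | .insert i _ =>
      let q := splitNth (visibleIn T (P e)) i l
      let run := q.2.takeWhile fun x => decide (x ∉ P e)
      let k := min (R.skip (run.map fun x => ⟨x, P x⟩) ⟨e, P e⟩) run.length
      q.1 ++ q.2.take k ++ e :: q.2.drop k
  | .delete _ => l

/-- The sequence of all insertions among the events `es`, processed in the given order. -/
def order (es : List (Evt ID C)) : List (Evt ID C) := es.foldl (integrate R P T) []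

/-- The entry of a document that an insertion creates. -/
def Evt.entry (x : Evt ID C) : Option (ID × C) :=
  match x.op with
  | .insert _ c => some (x.id, c)
  | .delete _ => none

/-- The document with the insertions `l`, of which those deleted by `D` are omitted. -/
def docOf (l D : List (Evt ID C)) : Doc ID C :=
  (l.filter fun x => decide (¬ DeletedIn T D x)).filterMap Evt.entry

/-- The index of `e` exists in the version that `e` sees if the sequence of insertions is `l`, and
if `e` is a deletion, then it deletes the character with the ID `T e`. -/
def StepOK (l : List (Evt ID C)) (e : Evt ID C) : Prop :=
  (∀ i c, e.op = .insert i c → i ≤ l.countP (visibleIn T (P e))) ∧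
    ∀ k, e.op = .delete k → ∃ A x B, l = A ++ x :: B ∧
      A.countP (visibleIn T (P e)) = k ∧ visibleIn T (P e) x = true ∧ T e = some x.id

/-- Properties of the pasts `P e` and the targets `T e` of the events of `G`. -/
structure Model (G : EventGraph ID C) : Prop where
  unique_id : ∀ a ∈ G, ∀ b ∈ G, a.id = b.id → a = b
  past_subset : ∀ e ∈ G, P e ⊆ G
  past_trans : ∀ e ∈ G, ∀ x ∈ P e, P x ⊆ P e
  notMem_past : ∀ e ∈ G, e ∉ P e
  target_insert : ∀ e ∈ G, e.IsInsert → T e = some e.id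
  target_mem : ∀ d ∈ G, ∀ x ∈ G, d ≠ x → T d = some x.id → x ∈ P d

end Model

section Abstract

variable {R : IntegrationRule ID C} {P : Evt ID C → EventGraph ID C} {T : Evt ID C → Option ID}
  {G : EventGraph ID C}

theorem Evt.isInsert_or_delete (e : Evt ID C) : e.IsInsert ∨ ∃ k, e.op = .delete k := by
  cases h : e.op with
  | insert i c => exact Or.inl ⟨i, c, h⟩
  | delete k => exact Or.inr ⟨k, rfl⟩

theorem Evt.not_isInsert {e : Evt ID C} {k : ℕ} (h : e.op = .delete k) : ¬ e.IsInsert := by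
  rintro ⟨i, c, h'⟩
  rw [h] at h'; cases h'

theorem order_append (u v : List (Evt ID C)) :
    order R P T (u ++ v) = v.foldl (integrate R P T) (order R P T u) := by
  simp [order]

theorem order_concat (u : List (Evt ID C)) (e : Evt ID C) :
    order R P T (u ++ [e]) = integrate R P T (order R P T u) e := by
  simp [order]

/-- An insertion adds a single element to the sequence. -/
theorem integrate_insert {l : List (Evt ID C)} {e : Evt ID C} (he : e.IsInsert) :
    ∃ A B, l = A ++ B ∧ integrate R P T l e = A ++ e :: B := by
  obtain ⟨i, c, h⟩ := he
  simp only [integrate, h]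
  refine ⟨_, _, ?_, rfl⟩
  rw [List.append_assoc, List.take_append_drop, splitNth_append]

theorem integrate_delete {l : List (Evt ID C)} {e : Evt ID C} {k : ℕ} (he : e.op = .delete k) :
    integrate R P T l e = l := by
  simp [integrate, he]

theorem mem_integrate {l : List (Evt ID C)} {e x : Evt ID C} :
    x ∈ integrate R P T l e ↔ x ∈ l ∨ (x = e ∧ e.IsInsert) := by
  rcases e.isInsert_or_delete with he | ⟨k, he⟩
  · obtain ⟨A, B, rfl, h⟩ := integrate_insert (R := R) (P := P) (T := T) (l := l) he
    rw [h]; simp [he]; tauto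
  · rw [integrate_delete he]; simp [Evt.not_isInsert he]

theorem mem_order {es : List (Evt ID C)} {x : Evt ID C} :
    x ∈ order R P T es ↔ x ∈ es ∧ x.IsInsert := by
  induction es using List.reverseRecOn with
  | nil => simp [order]
  | append_singleton es e ih =>
    rw [order_concat, mem_integrate, ih]
    simp only [List.mem_append, List.mem_singleton]
    constructor
    · rintro (h | ⟨rfl, h⟩)
      · exact ⟨Or.inl h.1, h.2⟩
      · exact ⟨Or.inr rfl, h⟩
    · rintro ⟨h | rfl, h'⟩
      · exact Or.inl ⟨h, h'⟩
      · exact Or.inr ⟨rfl, h'⟩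

theorem order_nodup {es : List (Evt ID C)} (hes : es.Nodup) : (order R P T es).Nodup := by
  induction es using List.reverseRecOn with
  | nil => simp [order]
  | append_singleton es e ih =>
    rw [order_concat]
    rw [List.nodup_append] at hes
    have hn := ih hes.1
    rcases e.isInsert_or_delete with he | ⟨k, he⟩
    · obtain ⟨A, B, h1, h2⟩ :=
        integrate_insert (R := R) (P := P) (T := T) (l := order R P T es) he
      rw [h2, List.nodup_middle, ← h1, List.nodup_cons]
      refine ⟨fun h => hes.2.2 e (mem_order.1 h).1 e (by simp) rfl, hn⟩
    · rwa [integrate_delete he]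

/-- Processing further events does not change the order of the earlier insertions. -/
theorem foldl_integrate_filter {l w : List (Evt ID C)} {q : Evt ID C → Bool}
    (hw : ∀ x ∈ w, q x = false) :
    (w.foldl (integrate R P T) l).filter q = l.filter q := by
  induction w generalizing l with
  | nil => rfl
  | cons e w ih =>
    rw [List.foldl_cons, ih fun x hx => hw x (by simp [hx])]
    rcases e.isInsert_or_delete with he | ⟨k, he⟩
    · obtain ⟨A, B, h1, h2⟩ := integrate_insert (R := R) (P := P) (T := T) (l := l) he
      rw [h2, h1]
      simp [hw e (by simp)]
    · rw [integrate_delete he]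

namespace Model

theorem mem_of_charState_ne_zero (hM : Model P T G) {Q : EventGraph ID C} (hQ : Q ⊆ G)
    (hP : ∀ e ∈ Q, P e ⊆ Q) {x : Evt ID C} (hx : x ∈ G) (h : charState T Q x ≠ 0) : x ∈ Q := by
  obtain ⟨d, hd⟩ := Finset.card_ne_zero.1 h
  rw [Finset.mem_filter] at hd
  by_cases hdx : d = x
  · exact hdx ▸ hd.1
  · exact hP d hd.1 (hM.target_mem d (hQ hd.1) x hx hdx hd.2)

theorem charState_pos (hM : Model P T G) {Q : EventGraph ID C} {x : Evt ID C} (hx : x ∈ G)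
    (hi : x.IsInsert) (hQ : x ∈ Q) : charState T Q x ≠ 0 := by
  refine Finset.card_ne_zero.2 ⟨x, ?_⟩
  rw [Finset.mem_filter]
  exact ⟨hQ, hM.target_insert x hx hi⟩

theorem charState_eq_zero_iff (hM : Model P T G) {Q : EventGraph ID C} (hQ : Q ⊆ G)
    (hP : ∀ e ∈ Q, P e ⊆ Q) {x : Evt ID C} (hx : x ∈ G) (hi : x.IsInsert) :
    charState T Q x = 0 ↔ x ∉ Q :=
  ⟨fun h hxQ => hM.charState_pos hx hi hxQ h, fun h => by
    by_contra h'
    exact h (hM.mem_of_charState_ne_zero hQ hP hx h')⟩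

theorem charState_eq_one_iff (hM : Model P T G) {Q : EventGraph ID C} (hQ : Q ⊆ G)
    (hP : ∀ e ∈ Q, P e ⊆ Q) {x : Evt ID C} (hx : x ∈ G) (hi : x.IsInsert) :
    charState T Q x = 1 ↔ x ∈ Q ∧ ∀ d ∈ Q, d ≠ x → T d ≠ some x.id := by
  constructor
  · intro h
    have hxQ := hM.mem_of_charState_ne_zero hQ hP hx (by omega)
    refine ⟨hxQ, fun d hd hdx hT => ?_⟩
    obtain ⟨y, hy⟩ := Finset.card_eq_one.1 h
    have h1 : x ∈ Q.filter fun d => T d = some x.id :=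
      Finset.mem_filter.2 ⟨hxQ, hM.target_insert x hx hi⟩
    have h2 : d ∈ Q.filter fun d => T d = some x.id := Finset.mem_filter.2 ⟨hd, hT⟩
    rw [hy, Finset.mem_singleton] at h1 h2
    exact hdx (h2.trans h1.symm)
  · rintro ⟨h1, h2⟩
    refine Finset.card_eq_one.2 ⟨x, ?_⟩
    ext d
    rw [Finset.mem_filter, Finset.mem_singleton]
    constructor
    · rintro ⟨hd, hT⟩
      by_contra hdx
      exact h2 d hd hdx hT
    · rintro rfl
      exact ⟨h1, hM.target_insert d hx hi⟩

end Model

/-! ### Convergence of the abstract replay -/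

/-- Swapping two concurrent events after at most `n - 2` others does not change the order. -/
def SwapBelow (R : IntegrationRule ID C) (P : Evt ID C → EventGraph ID C)
    (T : Evt ID C → Option ID) (G : EventGraph ID C) (n : ℕ) : Prop :=
  ∀ es a b, (es ++ [a, b]).length ≤ n → TopFrom G P ∅ (es ++ [a, b]) → a ∉ P b →
    order R P T (es ++ [a, b]) = order R P T (es ++ [b, a])

theorem SwapBelow.order_bubble {n : ℕ} (h : SwapBelow R P T G n) {u w : List (Evt ID C)}
    {a : Evt ID C} (hlen : (u ++ a :: w).length ≤ n) (htop : TopFrom G P ∅ (u ++ a :: w))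
    (ha : ∀ x ∈ w, a ∉ P x) :
    order R P T (u ++ a :: w) = order R P T (u ++ w ++ [a]) := by
  induction w generalizing u with
  | nil => simp
  | cons b w ih =>
    have hab := ha b (by simp)
    have h1 : order R P T (u ++ [a, b]) = order R P T (u ++ [b, a]) := by
      refine h u a b (by simp at hlen ⊢; omega) ?_ hab
      rw [show u ++ a :: b :: w = (u ++ [a, b]) ++ w by simp] at htop
      exact (topFrom_append.1 htop).1
    have h2 : order R P T (u ++ a :: b :: w) = order R P T ((u ++ [b]) ++ a :: w) := by
      rw [show u ++ a :: b :: w = (u ++ [a, b]) ++ w by simp,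
        show (u ++ [b]) ++ a :: w = (u ++ [b, a]) ++ w by simp, order_append, h1, ← order_append]
    rw [h2, ih (by simp at hlen ⊢; omega) (by simpa using topFrom_swap htop hab)
      fun x hx => ha x (by simp [hx])]
    simp

theorem topFrom_bubble {u w : List (Evt ID C)}
    {a : Evt ID C} (htop : TopFrom G P ∅ (u ++ a :: w))
    (ha : ∀ x ∈ w, a ∉ P x) : TopFrom G P ∅ (u ++ w ++ [a]) := by
  induction w generalizing u with
  | nil => simpa using htop
  | cons b w ih =>
    have := ih (u := u ++ [b]) (by simpa using topFrom_swap htop (ha b (by simp)))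
      fun x hx => ha x (by simp [hx])
    simpa using this

/-- The order of the insertions depends only on the set of events. -/
theorem SwapBelow.order_congr {n : ℕ} (h : SwapBelow R P T G n) {es es' : List (Evt ID C)}
    (hlen : es.length ≤ n) (hes : TopFrom G P ∅ es) (hes' : TopFrom G P ∅ es')
    (hmem : ∀ x, x ∈ es ↔ x ∈ es') : order R P T es = order R P T es' := by
  induction es using List.reverseRecOn generalizing es' with
  | nil =>
    have : es' = [] := List.eq_nil_iff_forall_not_mem.2 fun x hx => by simpa using (hmem x).2 hx
    rw [this]
  | append_singleton u a ih =>
    obtain ⟨v, w, rfl⟩ := List.append_of_mem ((hmem a).1 (by simp))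
    have hn := hes.nodup
    have hn' := hes'.nodup
    have hlen' : (v ++ a :: w).length = (u ++ [a]).length :=
      (List.Perm.length_eq ((List.perm_ext_iff_of_nodup hn hn').2 hmem)).symm
    have haP : ∀ x ∈ v ++ a :: w, a ∉ P x := by
      intro x hx hax
      have hx' := (hmem x).2 hx
      rcases List.mem_append.1 hx' with hx' | hx'
      · have := (topFrom_append.1 hes).1.past_subset hx' hax
        rw [List.nodup_append] at hn
        exact hn.2.2 a this a (by simp) rfl
      · rw [List.mem_singleton] at hx'
        subst hx'
        have := (topFrom_append.1 hes).2.2.2.1 x hax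
        rw [List.nodup_append] at hn
        exact hn.2.2 x (by simpa using this) x (by simp) rfl
    have haw : ∀ x ∈ w, a ∉ P x := fun x hx => haP x (by simp [hx])
    rw [h.order_bubble (by omega) hes' haw, order_concat, order_concat]
    congr 1
    have htop := topFrom_bubble hes' haw
    refine ih (by simp at hlen; omega) (topFrom_append.1 hes).1 (topFrom_append.1 htop).1 ?_
    intro x
    have h1 := hmem x
    rw [List.nodup_append] at hn
    rw [List.nodup_middle, List.nodup_cons] at hn'
    have h2 : x = a → (x ∉ u ∧ x ∉ v ++ w) := by
      rintro rfl
      exact ⟨fun hx => hn.2.2 x hx x (by simp) rfl, hn'.1⟩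
    simp only [List.mem_append, List.mem_cons] at h1 h2 ⊢
    tauto

end Abstract

/-! ### Documents -/

theorem length_filterMap_entry {l : List (Evt ID C)} (hl : ∀ x ∈ l, x.IsInsert) :
    (l.filterMap Evt.entry).length = l.length := by
  induction l with
  | nil => rfl
  | cons a l ih =>
    obtain ⟨i, c, h⟩ := hl a (by simp)
    have : a.entry = some (a.id, c) := by simp [Evt.entry, h]
    rw [List.filterMap_cons_some this]
    simp [ih fun x hx => hl x (by simp [hx])]

theorem getElem?_filterMap_entry {l : List (Evt ID C)} (hl : ∀ x ∈ l, x.IsInsert) (k : ℕ) :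
    (l.filterMap Evt.entry)[k]? = l[k]?.bind Evt.entry := by
  induction l generalizing k with
  | nil => rfl
  | cons a l ih =>
    obtain ⟨i, c, h⟩ := hl a (by simp)
    have : a.entry = some (a.id, c) := by simp [Evt.entry, h]
    rw [List.filterMap_cons_some this]
    cases k with
    | zero => simp [this]
    | succ k => simpa using ih (fun x hx => hl x (by simp [hx])) k

section DocOf

variable {R : IntegrationRule ID C} {P : Evt ID C → EventGraph ID C} {T : Evt ID C → Option ID}
  {G : EventGraph ID C}

theorem docOf_append (A B D : List (Evt ID C)) :
    docOf T (A ++ B) D = docOf T A D ++ docOf T B D := by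
  simp [docOf]

theorem length_docOf {A D : List (Evt ID C)} (hA : ∀ x ∈ A, x.IsInsert) :
    (docOf T A D).length = A.countP fun x => decide (¬ DeletedIn T D x) := by
  rw [docOf, length_filterMap_entry fun x hx => hA x (List.mem_filter.1 hx).1,
    List.countP_eq_length_filter]

theorem docOf_congr {A D D' : List (Evt ID C)}
    (h : ∀ x ∈ A, (DeletedIn T D x ↔ DeletedIn T D' x)) : docOf T A D = docOf T A D' := by
  rw [docOf, docOf, List.filter_congr]
  intro x hx
  simp [h x hx]

theorem insertIdx_length_append {α : Type*} (a b : List α) (x : α) :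
    (a ++ b).insertIdx a.length x = a ++ x :: b := by
  induction a with
  | nil => simp
  | cons y a ih => simpa using ih

theorem eraseIdx_length_append {α : Type*} (a b : List α) (x : α) :
    (a ++ x :: b).eraseIdx a.length = a ++ b := by
  induction a with
  | nil => simp
  | cons y a ih => simpa using ih

theorem deletedIn_concat {D : List (Evt ID C)} {e x : Evt ID C} :
    DeletedIn T (D ++ [e]) x ↔ DeletedIn T D x ∨ (e ≠ x ∧ T e = some x.id) := by
  simp only [DeletedIn, List.mem_append, List.mem_singleton]
  constructor
  · rintro ⟨d, hd | rfl, h⟩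
    · exact Or.inl ⟨d, hd, h⟩
    · exact Or.inr h
  · rintro (⟨d, hd, h⟩ | h)
    · exact ⟨d, Or.inl hd, h⟩
    · exact ⟨e, Or.inr rfl, h⟩

/-- `D` lists events of `G` with their pasts, and `e` is a further event whose past is in `D`. -/
structure NextEvent (P : Evt ID C → EventGraph ID C) (G : EventGraph ID C) (D : List (Evt ID C))
    (e : Evt ID C) : Prop where
  subset : ∀ x ∈ D, x ∈ G
  closed : ∀ x ∈ D, ∀ y ∈ P x, y ∈ D
  nodup : D.Nodup
  mem : e ∈ G
  notMem : e ∉ D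
  past : ∀ x ∈ P e, x ∈ D

theorem NextEvent.id_ne (hM : Model P T G) {D : List (Evt ID C)} {e x : Evt ID C}
    (hn : NextEvent P G D e) (hx : x ∈ D) : x.id ≠ e.id := fun h =>
  hn.notMem (hM.unique_id _ (hn.subset x hx) _ hn.mem h ▸ hx)

theorem NextEvent.target_ne (hM : Model P T G) {D : List (Evt ID C)} {e d : Evt ID C}
    (hn : NextEvent P G D e) (hd : d ∈ D) : T d ≠ some e.id := fun h =>
  hn.notMem (hn.closed d hd e
    (hM.target_mem d (hn.subset d hd) e hn.mem (fun hde => hn.notMem (hde ▸ hd)) h))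

theorem NextEvent.not_deletedIn (hM : Model P T G) {D : List (Evt ID C)} {e : Evt ID C}
    (hn : NextEvent P G D e) : ¬ DeletedIn T (D ++ [e]) e := by
  rw [deletedIn_concat]
  rintro (⟨d, hd, -, h⟩ | ⟨h, -⟩)
  · exact hn.target_ne hM hd h
  · exact h rfl

theorem docOf_insert (hM : Model P T G) {D A B : List (Evt ID C)} {e : Evt ID C} {i : ℕ} {c : C}
    (hn : NextEvent P G D e) (he : e.op = .insert i c) (hD : ∀ x ∈ A ++ B, x ∈ D)
    (hI : ∀ x ∈ A ++ B, x.IsInsert) :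
    docOf T (A ++ e :: B) (D ++ [e]) = (docOf T (A ++ B) D).insertIdx
      (A.countP fun x => decide (¬ DeletedIn T D x)) (e.id, c) := by
  have hdel : ∀ x ∈ A ++ B, (DeletedIn T (D ++ [e]) x ↔ DeletedIn T D x) := by
    intro x hx
    rw [deletedIn_concat, hM.target_insert e hn.mem ⟨i, c, he⟩]
    simp only [Option.some.injEq, or_iff_left_iff_imp, and_imp]
    exact fun _ h => absurd h.symm (hn.id_ne hM (hD x hx))
  rw [docOf_append, docOf_append, ← length_docOf (fun x hx => hI x (by simp [hx])),
    insertIdx_length_append, docOf_congr (A := A) fun x hx => hdel x (by simp [hx])]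
  congr 1
  rw [← docOf_congr (A := B) fun x hx => hdel x (by simp [hx])]
  simp [docOf, hn.not_deletedIn hM, Evt.entry, he]

theorem docOf_delete (hM : Model P T G) {D A B : List (Evt ID C)} {e x : Evt ID C} {k : ℕ}
    (hn : NextEvent P G D e) (he : e.op = .delete k) (hT : T e = some x.id)
    (hD : ∀ y ∈ A ++ x :: B, y ∈ D) (hI : ∀ y ∈ A ++ x :: B, y.IsInsert)
    (hnd : (A ++ x :: B).Nodup) :
    docOf T (A ++ x :: B) (D ++ [e]) = if DeletedIn T D x then docOf T (A ++ x :: B) D else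
      (docOf T (A ++ x :: B) D).eraseIdx (A.countP fun x => decide (¬ DeletedIn T D x)) := by
  rw [List.nodup_middle, List.nodup_cons] at hnd
  have hdel : ∀ y ∈ A ++ B, (DeletedIn T (D ++ [e]) y ↔ DeletedIn T D y) := by
    intro y hy
    rw [deletedIn_concat, hT]
    simp only [Option.some.injEq, or_iff_left_iff_imp, and_imp]
    intro _ h
    have hy' : y ∈ A ++ x :: B := by simp at hy ⊢; tauto
    have := hM.unique_id x (hn.subset x (hD x (by simp))) y (hn.subset y (hD y hy')) h
    exact absurd (this ▸ hy) hnd.1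
  have hex : e ≠ x := fun h => Evt.not_isInsert he (h ▸ hI x (by simp))
  have hx : DeletedIn T (D ++ [e]) x := deletedIn_concat.2 (Or.inr ⟨hex, hT⟩)
  have hB : docOf T (x :: B) (D ++ [e]) = docOf T B D := by
    rw [← docOf_congr (A := B) fun x hx => hdel x (by simp [hx])]
    simp [docOf, hx]
  rw [docOf_append, docOf_append, hB, docOf_congr (A := A) fun x hx => hdel x (by simp [hx])]
  split_ifs with h
  · congr 1
    simp [docOf, h]
  · obtain ⟨i, c, hc⟩ := hI x (by simp)
    have : docOf T (x :: B) D = (x.id, c) :: docOf T B D := by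
      simp [docOf, h, Evt.entry, hc]
    rw [this, ← length_docOf (fun x hx => hI x (by simp [hx])), eraseIdx_length_append]

end DocOf

/-! ### The internal state represents the abstract sequence -/

section Simulation

variable (P : Evt ID C → EventGraph ID C) (T : Evt ID C → Option ID)

/-- The character inserted by `x` was deleted before the internal state was last cleared, when the
events `S₀` had been processed. -/
def IsDead (S₀ : EventGraph ID C) (x : Evt ID C) : Prop :=
  x ∈ S₀ ∧ ∃ d ∈ S₀, d ≠ x ∧ T d = some x.id

/-- The character inserted by `x` was present when the internal state was last cleared, and none
of the processed events `D` deletes it. -/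
def IsAlive (S₀ : EventGraph ID C) (D : List (Evt ID C)) (x : Evt ID C) : Prop :=
  x ∈ S₀ ∧ ∀ d ∈ D, d ≠ x → T d ≠ some x.id

/-- The record `r` correctly describes the character inserted by `x`, whose state in the prepare
version is `σ x`. If `x` was processed before the internal state was last cleared, then `r` was
split off a placeholder; otherwise `r` is the record created by `x`. The targets `τ` stored in the
internal state lead to `r` from those events that insert or delete this character. -/
structure RecOK (S₀ : EventGraph ID C) (D : List (Evt ID C)) (τ : ID → Option ID)
    (σ : Evt ID C → ℕ) (x : Evt ID C) (r : Record ID C) : Prop where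
  evt_mem : r.evt ∈ D
  evt_notMem : r.evt ∉ S₀
  created : x ∉ S₀ → r.evt = x ∧ r.past = P x
  sp_eq : r.sp = σ x
  deleted_iff : r.deleted = true ↔ DeletedIn T D x
  target_iff : ∀ d ∈ D, d ∉ S₀ → (τ d.id = some r.evt.id ↔ T d = some x.id)
  target_self : τ r.evt.id = some r.evt.id

/-- The internal state `st` is correct after processing `D`, with `Q` as the set of events of the
prepare version and `l` as the sequence of all insertions, if it was last cleared when `S₀` had been
processed (`S₀ = ∅` if it has never been cleared). -/
structure StateOK (G : EventGraph ID C) (S₀ : EventGraph ID C) (D : List (Evt ID C))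
    (Q : EventGraph ID C) (st : State ID C) (l : List (Evt ID C)) : Prop where
  prep_eq : events G st.prep = Q
  base_subset : S₀ ⊆ Q
  prep_subset : ∀ x ∈ Q, x ∈ D
  rep : Rep (IsDead T S₀) (IsAlive T S₀ D) (RecOK P T S₀ D st.target (charState T Q)) True
    l st.items
  target_mem : ∀ d ∈ D, d ∉ S₀ → ∀ j, st.target d.id = some j → ∃ f ∈ D, f.id = j
  base_past : ∀ b ∈ G, b ∉ S₀ → S₀ ⊆ P b
  chain : l.IsChain fun x y => IsDead T S₀ x → y ∈ S₀

end Simulation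

section Internal

variable {R : IntegrationRule ID C} {P : Evt ID C → EventGraph ID C} {T : Evt ID C → Option ID}
  {G S₀ Q : EventGraph ID C} {D l : List (Evt ID C)} {st : State ID C} {o : Prop}

theorem rep_foldl_modifyTarget {Dead Alive : Evt ID C → Prop} (f : ℕ → ℕ) {ds : List (Evt ID C)}
    {σ : Evt ID C → ℕ} (hds : ∀ d ∈ ds, d ∈ D ∧ d ∉ S₀)
    (h : Rep Dead Alive (RecOK P T S₀ D st.target σ) o l st.items) :
    (ds.foldl (fun s d => s.modifyTarget d f) st).target = st.target ∧
    Rep Dead Alive (RecOK P T S₀ D st.target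
        fun x => f^[ds.countP fun d => decide (T d = some x.id)] (σ x)) o l
      (ds.foldl (fun s d => s.modifyTarget d f) st).items := by
  induction ds generalizing st σ with
  | nil => exact ⟨rfl, h⟩
  | cons d ds ih =>
    obtain ⟨hd, hdS⟩ := hds d (by simp)
    have h1 : Rep Dead Alive (RecOK P T S₀ D (st.modifyTarget d f).target
        fun x => if T d = some x.id then f (σ x) else σ x) o l (st.modifyTarget d f).items := by
      refine h.mono _ (fun n => rfl) id (fun _ _ h => h) (fun _ _ h => h) fun x _ r hr => ?_
      have ht := hr.target_iff d hd hdS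
      by_cases hT : T d = some x.id
      · refine ⟨{ r with sp := f r.sp }, by simp [ht.2 hT], ?_⟩
        exact ⟨hr.evt_mem, hr.evt_notMem, hr.created, by simp [hT, hr.sp_eq], hr.deleted_iff,
          hr.target_iff, hr.target_self⟩
      · refine ⟨r, by simp [mt ht.1 hT], ?_⟩
        exact ⟨hr.evt_mem, hr.evt_notMem, hr.created, by simp [hT, hr.sp_eq], hr.deleted_iff,
          hr.target_iff, hr.target_self⟩
    obtain ⟨h2, h3⟩ := ih (fun d hd => hds d (by simp [hd])) h1
    refine ⟨h2, ?_⟩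
    have hσ : (fun x : Evt ID C => f^[(d :: ds).countP fun d => decide (T d = some x.id)] (σ x)) =
        fun x => f^[ds.countP fun d => decide (T d = some x.id)]
          (if T d = some x.id then f (σ x) else σ x) := by
      funext x
      rw [List.countP_cons]
      by_cases hT : T d = some x.id
      · simp [hT, Function.iterate_succ_apply]
      · simp [hT]
    rw [hσ]
    exact h3

theorem countP_filter_mem {α : Type*} {D : List α} (hD : D.Nodup) {S : Finset α}
    (hS : ∀ x ∈ S, x ∈ D) {q : α → Prop} [DecidablePred q]
    (hq : ∀ x ∈ D, q x ↔ x ∈ S) (p : α → Prop) [DecidablePred p] :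
    (D.filter fun x => decide (q x)).countP (fun x => decide (p x)) = (S.filter p).card := by
  rw [List.countP_eq_length_filter, ← List.toFinset_card_of_nodup ((hD.filter _).filter _)]
  congr 1
  ext x
  simp only [List.mem_toFinset, List.mem_filter, decide_eq_true_eq, Finset.mem_filter]
  constructor
  · rintro ⟨⟨h1, h2⟩, h3⟩
    exact ⟨(hq x h1).1 h2, h3⟩
  · rintro ⟨h1, h2⟩
    exact ⟨⟨hS x h1, (hq x (hS x h1)).2 h1⟩, h2⟩

/-- Retreating and advancing moves the internal state to the prepare version of the next event. -/
theorem StateOK.prepare (h : StateOK P T G S₀ D Q st l) {e : Evt ID C} (hn : NextEvent P G D e)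
    (hP : events G e.parents = P e) (heS : e ∉ S₀) :
    StateOK P T G S₀ D (P e) (st.prepare G D e.parents) l := by
  have hSP := h.base_past e hn.mem heS
  set ds₁ := D.reverse.filter fun x => decide (x ∈ Q ∧ x ∉ P e) with hds₁
  set ds₂ := D.filter fun x => decide (x ∈ P e ∧ x ∉ Q) with hds₂
  have hst : st.prepare G D e.parents =
      { ds₂.foldl (fun s d => s.modifyTarget d (· + 1))
          (ds₁.foldl (fun s d => s.modifyTarget d (· - 1)) st) with prep := e.parents } := by
    simp only [State.prepare, h.prep_eq, hP]
    rfl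
  have hm₁ : ∀ d ∈ ds₁, d ∈ D ∧ d ∉ S₀ := by
    intro d hd
    simp only [hds₁, List.mem_filter, List.mem_reverse, decide_eq_true_eq] at hd
    exact ⟨hd.1, fun hS => hd.2.2 (hSP hS)⟩
  have hm₂ : ∀ d ∈ ds₂, d ∈ D ∧ d ∉ S₀ := by
    intro d hd
    simp only [hds₂, List.mem_filter, decide_eq_true_eq] at hd
    exact ⟨hd.1, fun hS => hd.2.2 (h.base_subset hS)⟩
  obtain ⟨ht₁, hr₁⟩ := rep_foldl_modifyTarget (· - 1) hm₁ h.rep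
  rw [← ht₁] at hr₁
  obtain ⟨ht₂, hr₂⟩ := rep_foldl_modifyTarget (· + 1) hm₂ hr₁
  rw [ht₁] at ht₂ hr₂
  rw [hst]
  refine ⟨hP, hSP, hn.past, ?_, ?_, h.base_past, h.chain⟩
  · simp only [ht₂]
    refine hr₂.weaken id (fun _ _ h => h) (fun _ _ h => h) fun x _ r hr => ?_
    refine ⟨hr.evt_mem, hr.evt_notMem, hr.created, ?_, hr.deleted_iff,
          hr.target_iff, hr.target_self⟩
    have hsub : ∀ a k : ℕ, (· - 1)^[k] a = a - k := by
      intro a k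
      induction k with
      | zero => rfl
      | succ k ih => rw [Function.iterate_succ_apply', ih]; omega
    have hadd : ∀ a k : ℕ, (· + 1)^[k] a = a + k := by
      intro a k
      induction k with
      | zero => rfl
      | succ k ih => rw [Function.iterate_succ_apply', ih]; omega
    have h1 : ds₁.countP (fun d => decide (T d = some x.id)) =
        ((Q \ P e).filter fun d => T d = some x.id).card :=
      countP_filter_mem (S := Q \ P e) (List.nodup_reverse.2 hn.nodup) (fun y hy => by
        simpa using h.prep_subset y (Finset.mem_sdiff.1 hy).1)
      (fun _ _ => Finset.mem_sdiff.symm) _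
    have h2 : ds₂.countP (fun d => decide (T d = some x.id)) =
        ((P e \ Q).filter fun d => T d = some x.id).card :=
      countP_filter_mem (S := P e \ Q) hn.nodup (fun y hy => hn.past y (Finset.mem_sdiff.1 hy).1)
      (fun _ _ => Finset.mem_sdiff.symm) _
    rw [hr.sp_eq, hsub, hadd, h1, h2]
    -- both sides count the part that is common to both versions and the part to be advanced
    have hs : ∀ A B : EventGraph ID C, charState T A x =
        ((A \ B).filter fun d => T d = some x.id).card +
          ((A ∩ B).filter fun d => T d = some x.id).card := by
      intro A B
      rw [charState, ← Finset.card_union_of_disjoint, ← Finset.filter_union,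
        Finset.sdiff_union_inter]
      exact Finset.disjoint_filter_filter (Finset.disjoint_sdiff_inter A B)
    rw [hs Q (P e), hs (P e) Q, Finset.inter_comm (P e) Q]
    omega
  · simp only [ht₂]
    exact h.target_mem

theorem charState_insert {e x : Evt ID C} (heQ : e ∉ Q) :
    charState T (insert e Q) x = charState T Q x + if T e = some x.id then 1 else 0 := by
  rw [charState, Finset.filter_insert]
  split_ifs with h
  · rw [Finset.card_insert_of_notMem (fun h' => heQ (Finset.mem_filter.1 h').1)]; rfl
  · rfl

/-- Processing an event does not affect the records of characters other than its target. -/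
theorem RecOK.update {S₀ : EventGraph ID C} {τ : ID → Option ID} {e x : Evt ID C}
    {r : Record ID C} {m : ID} (hM : Model P T G)
    (h : RecOK P T S₀ D τ (charState T Q) x r) (hn : NextEvent P G D e) (heQ : e ∉ Q)
    (hT : T e ≠ some x.id) (hm : m ≠ r.evt.id) :
    RecOK P T S₀ (D ++ [e]) (Function.update τ e.id (some m)) (charState T (insert e Q)) x r := by
  refine ⟨by simp [h.evt_mem], h.evt_notMem, h.created, ?_, ?_, ?_, ?_⟩
  · rw [charState_insert heQ, if_neg hT, h.sp_eq, add_zero]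
  · rw [h.deleted_iff, deletedIn_concat]
    simp [hT]
  · intro d hd hdS
    rcases List.mem_append.1 hd with hd | hd
    · rw [Function.update_of_ne (hn.id_ne hM hd)]
      exact h.target_iff d hd hdS
    · rw [List.mem_singleton] at hd
      subst hd
      simp [hm, hT]
  · rw [Function.update_of_ne (hn.id_ne hM h.evt_mem)]
    exact h.target_self

theorem IsAlive.update {e x : Evt ID C} (hT : T e ≠ some x.id) (h : IsAlive T S₀ D x) :
    IsAlive T S₀ (D ++ [e]) x := by
  refine ⟨h.1, fun d hd => ?_⟩
  rcases List.mem_append.1 hd with hd | hd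
  · exact h.2 d hd
  · rw [List.mem_singleton] at hd
    exact fun _ => hd ▸ hT

/-- The data needed to process the event `e` in an internal state that has been prepared for it. -/
structure Ready (P : Evt ID C → EventGraph ID C) (T : Evt ID C → Option ID)
    (G S₀ : EventGraph ID C) (D : List (Evt ID C)) (st : State ID C) (l : List (Evt ID C))
    (e : Evt ID C) : Prop where
  model : Model P T G
  next : NextEvent P G D e
  notMem_base : e ∉ S₀
  state : StateOK P T G S₀ D (P e) st l
  mem_iff : ∀ x, x ∈ l ↔ x ∈ D ∧ x.IsInsert
  nodup : l.Nodup
  events_eq : events G {e.id} = insert e (P e)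

namespace Ready

variable {e : Evt ID C}

theorem base_past (h : Ready P T G S₀ D st l e) : S₀ ⊆ P e :=
  h.state.base_subset

theorem mem_graph (h : Ready P T G S₀ D st l e) {x : Evt ID C} (hx : x ∈ l) : x ∈ G :=
  h.next.subset x ((h.mem_iff x).1 hx).1

theorem charState_eq_zero_iff (h : Ready P T G S₀ D st l e) {x : Evt ID C} (hx : x ∈ l) :
    charState T (P e) x = 0 ↔ x ∉ P e :=
  h.model.charState_eq_zero_iff (h.model.past_subset e h.next.mem)
    (h.model.past_trans e h.next.mem) (h.mem_graph hx) ((h.mem_iff x).1 hx).2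

theorem charState_eq_one_iff (h : Ready P T G S₀ D st l e) {x : Evt ID C} (hx : x ∈ l) :
    charState T (P e) x = 1 ↔ x ∈ P e ∧ ∀ d ∈ P e, d ≠ x → T d ≠ some x.id :=
  h.model.charState_eq_one_iff (h.model.past_subset e h.next.mem)
    (h.model.past_trans e h.next.mem) (h.mem_graph hx) ((h.mem_iff x).1 hx).2

theorem not_visible_of_isDead (h : Ready P T G S₀ D st l e) {x : Evt ID C} (hx : x ∈ l)
    (hd : IsDead T S₀ x) : visibleIn T (P e) x = false := by
  obtain ⟨-, d, hd, hdx, hT⟩ := hd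
  simp only [visibleIn, decide_eq_false_iff_not, h.charState_eq_one_iff hx]
  exact fun h' => h'.2 d (h.base_past hd) hdx hT

theorem visible_of_isAlive (h : Ready P T G S₀ D st l e) {x : Evt ID C} (hx : x ∈ l)
    (ha : IsAlive T S₀ D x) : visibleIn T (P e) x = true := by
  simp only [visibleIn, decide_eq_true_eq, h.charState_eq_one_iff hx]
  exact ⟨h.base_past ha.1, fun d hd => ha.2 d (h.next.past d hd)⟩

theorem deletedIn_of_isDead (h : Ready P T G S₀ D st l e) {x : Evt ID C}
    (hd : IsDead T S₀ x) : DeletedIn T D x := by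
  obtain ⟨-, d, hd, hdx⟩ := hd
  exact ⟨d, h.next.past d (h.base_past hd), hdx⟩

theorem not_deletedIn_of_isAlive {x : Evt ID C}
    (ha : IsAlive T S₀ D x) : ¬ DeletedIn T D x := fun ⟨d, hd, hdx, hT⟩ => ha.2 d hd hdx hT

theorem effIndex_eq (h : Ready P T G S₀ D st l e) {A : List (Evt ID C)} {s : List (Item ID C)}
    {τ : ID → Option ID} {σ : Evt ID C → ℕ}
    (hr : Rep (IsDead T S₀) (IsAlive T S₀ D) (RecOK P T S₀ D τ σ) False A s) :
    effIndex s = A.countP fun x => decide (¬ DeletedIn T D x) := by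
  refine hr.effIndex_eq (fun x _ hd => ?_) (fun x _ ha => ?_) fun x _ r hr => ?_
  · simpa using h.deletedIn_of_isDead hd
  · simpa using not_deletedIn_of_isAlive ha
  · have := hr.deleted_iff
    by_cases hd : DeletedIn T D x <;> simp [hd] at this ⊢ <;> exact this

theorem mem_insert (h : Ready P T G S₀ D st l e) :
    ∀ x ∈ insert e (P e), x ∈ D ++ [e] := by
  intro x hx
  rcases Finset.mem_insert.1 hx with rfl | hx
  · simp
  · simp [h.next.past x hx]

/-- Applying an insertion keeps the internal state correct, and the transformed operation has the
effect of the insertion on the document. -/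
theorem applyInsert (h : Ready P T G S₀ D st l e) {i : ℕ} {c : C} (he : e.op = .insert i c)
    (hok : StepOK P T l e) :
    StateOK P T G S₀ (D ++ [e]) (insert e (P e)) (st.applyInsert R e (P e) i c).1
        (integrate R P T l e) ∧
      applyOp (docOf T l D) e.id (st.applyInsert R e (P e) i c).2 =
        docOf T (integrate R P T l e) (D ++ [e]) := by
  have hM := h.model
  have hTe : T e = some e.id := hM.target_insert e h.next.mem ⟨i, c, he⟩
  have hvis : ∀ x ∈ l, ∀ r, RecOK P T S₀ D st.target (charState T (P e)) x r →
      (r.sp = 1 ↔ visibleIn T (P e) x = true) := fun x _ r hr => by simp [visibleIn, hr.sp_eq]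
  obtain ⟨hs1, hs2⟩ := h.state.rep.split (fun x => h.not_visible_of_isDead)
    (fun x => h.visible_of_isAlive) hvis (hok.1 i c he)
  have hlast := splitNth_last (visibleIn T (P e)) (hok.1 i c he)
  have happ := splitNth_append (visibleIn T (P e)) i l
  simp only [integrate, he, State.applyInsert]
  set A := (splitNth (visibleIn T (P e)) i l).1
  set B := (splitNth (visibleIn T (P e)) i l).2
  set s1 := (splitPrep i st.items).1
  set s2 := (splitPrep i st.items).2
  have hBl : ∀ x ∈ B, x ∈ l := fun x hx => happ ▸ List.mem_append_right _ hx
  have hchain : (A ++ B).IsChain fun x y => IsDead T S₀ x → y ∈ S₀ := happ ▸ h.state.chain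
  obtain ⟨hrun, htd⟩ := hs2.run (S := fun x => x ∈ S₀) (q := fun x => decide (x ∉ P e))
    Record.insertOp (fun x => ⟨x, P x⟩)
    (fun x _ hd => by simpa using h.base_past hd.1) (fun x _ ha => by simpa using h.base_past ha.1)
    (fun x hx r hr => by
      refine ⟨by rw [hr.sp_eq, h.charState_eq_zero_iff (hBl x hx)]; simp, fun hq => ?_⟩
      have := hr.created fun hS => by simp [h.base_past hS] at hq
      simp [Record.insertOp, this.1, this.2])
    (fun x _ hS => by simpa using h.base_past hS) (List.isChain_append.1 hchain).2.1
  have hlen : (notInsertedRun s2).length = (B.takeWhile fun x => decide (x ∉ P e)).length := by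
    simpa using congrArg List.length hrun
  rw [hrun, hlen]
  set run := B.takeWhile fun x => decide (x ∉ P e)
  set k := min (R.skip (run.map fun x => ⟨x, P x⟩) ⟨e, P e⟩) run.length
  obtain ⟨ht, hd⟩ := htd k (min_le_right _ _)
  have hbefore := hs1.append ht
  have hl : l = (A ++ B.take k) ++ B.drop k := by
    rw [List.append_assoc, List.take_append_drop, happ]
  have hupd : ∀ x ∈ l, ∀ r, RecOK P T S₀ D st.target (charState T (P e)) x r →
      RecOK P T S₀ (D ++ [e]) (Function.update st.target e.id (some e.id))
        (charState T (insert e (P e))) x r := by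
    intro x hx r hr
    refine hr.update hM h.next (hM.notMem_past e h.next.mem) ?_ ?_
    · rw [hTe]
      exact fun h' => h.next.id_ne hM ((h.mem_iff x).1 hx).1 (Option.some.inj h').symm
    · exact (h.next.id_ne hM hr.evt_mem).symm
  have halive : ∀ x ∈ l, IsAlive T S₀ D x → IsAlive T S₀ (D ++ [e]) x := fun x hx ha =>
    ha.update (by
      rw [hTe]
      exact fun h' => h.next.id_ne hM ((h.mem_iff x).1 hx).1 (Option.some.inj h').symm)
  refine ⟨⟨h.events_eq, h.base_past.trans (Finset.subset_insert _ _), h.mem_insert, ?_, ?_,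
    h.state.base_past, ?_⟩, ?_⟩
  · have hAl : ∀ x ∈ A ++ B.take k, x ∈ l := fun x hx => hl ▸ List.mem_append_left _ hx
    have hDl : ∀ x ∈ B.drop k, x ∈ l := fun x hx => hl ▸ List.mem_append_right _ hx
    have hrec : RecOK P T S₀ (D ++ [e]) (Function.update st.target e.id (some e.id))
        (charState T (insert e (P e))) e ⟨e, P e, 1, false⟩ := by
      refine ⟨by simp, h.notMem_base, fun _ => ⟨rfl, rfl⟩, ?_, ?_, ?_, by simp⟩
      · rw [charState_insert (hM.notMem_past e h.next.mem), if_pos hTe]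
        have : charState T (P e) e = 0 := by
          refine Finset.card_eq_zero.2 (Finset.filter_eq_empty_iff.2 fun d hd => ?_)
          exact h.next.target_ne hM (h.next.past d hd)
        simp [this]
      · simpa using h.next.not_deletedIn hM
      · intro d hd hdS
        rcases List.mem_append.1 hd with hd | hd
        · rw [Function.update_of_ne (h.next.id_ne hM hd)]
          refine iff_of_false (fun h' => ?_) (h.next.target_ne hM hd)
          obtain ⟨f, hf, hfe⟩ := h.state.target_mem d hd hdS _ h'
          exact h.next.id_ne hM hf hfe
        · rw [List.mem_singleton] at hd
          subst hd
          simp [hTe]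
    refine Rep.append (hbefore.weaken id (fun _ _ h => h) (fun x hx => halive x (hAl x hx))
      fun x hx => hupd x (hAl x hx)) (.record hrec ?_)
    exact hd.weaken id (fun _ _ h => h) (fun x hx => halive x (hDl x hx))
      fun x hx => hupd x (hDl x hx)
  · intro d hd hdS j hj
    simp only at hj
    rcases List.mem_append.1 hd with hd | hd
    · rw [Function.update_of_ne (h.next.id_ne hM hd)] at hj
      obtain ⟨f, hf, hfe⟩ := h.state.target_mem d hd hdS _ hj
      exact ⟨f, by simp [hf], hfe⟩
    · rw [List.mem_singleton] at hd
      subst hd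
      simp at hj
      exact ⟨d, by simp, hj⟩
  · -- the new record does not follow a tombstone from before the last clearing
    have hc := h.state.chain
    rw [hl, List.isChain_append] at hc
    rw [List.isChain_append, List.isChain_cons]
    refine ⟨hc.1, ⟨fun y _ hde => absurd hde.1 h.notMem_base, hc.2.1⟩, ?_⟩
    intro x hx y hy hdx
    exfalso
    rw [List.getLast?_append] at hx
    cases htk : (B.take k).getLast? with
    | some z =>
      simp [htk] at hx
      subst hx
      have hz : z ∈ B.take k := List.mem_of_getLast? htk
      have hz' : z ∈ run := by
        have : B.take k <+: run :=
          List.prefix_of_prefix_length_le (List.take_prefix _ _) (List.takeWhile_prefix _)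
            (by simp; exact Or.inl (min_le_right _ _))
        exact this.subset hz
      have := List.mem_takeWhile_imp hz'
      simp [h.base_past hdx.1] at this
    | none =>
      simp [htk] at hx
      rcases hlast with ⟨-, hA⟩ | ⟨A', z, hA, hz⟩
      · simp [A, hA] at hx
      · have hA' : A = A' ++ [z] := hA
        rw [hA'] at hx
        simp at hx
        subst hx
        have hzl : z ∈ l := by rw [← happ, hA']; simp
        rw [h.not_visible_of_isDead hzl hdx] at hz
        cases hz
  · simp only [applyOp]
    rw [h.effIndex_eq hbefore,
      docOf_insert hM h.next he (fun x hx => ((h.mem_iff x).1 (hl ▸ hx)).1)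
        (fun x hx => ((h.mem_iff x).1 (hl ▸ hx)).2), ← hl]

/-- A deletion replaces the entry of its target `x` by a record `r'` that is the new target of the
deletion, or splits `r'` off a placeholder. -/
theorem delete_stateOK (h : Ready P T G S₀ D st l e) {A B : List (Evt ID C)} {x : Evt ID C}
    (hl : l = A ++ x :: B) (hT : T e = some x.id) {before rest : List (Item ID C)}
    (hA : Rep (IsDead T S₀) (IsAlive T S₀ D) (RecOK P T S₀ D st.target (charState T (P e))) False
      A before)
    (hB : Rep (IsDead T S₀) (IsAlive T S₀ D) (RecOK P T S₀ D st.target (charState T (P e))) True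
      B rest) {r' : Record ID C}
    (hr' : RecOK P T S₀ (D ++ [e]) (Function.update st.target e.id (some r'.evt.id))
      (charState T (insert e (P e))) x r')
    (hne : ∀ y ∈ l, y ≠ x → ∀ r, RecOK P T S₀ D st.target (charState T (P e)) y r →
      r'.evt.id ≠ r.evt.id) :
    StateOK P T G S₀ (D ++ [e]) (insert e (P e))
      { items := before ++ .record r' :: rest
        target := Function.update st.target e.id (some r'.evt.id)
        prep := {e.id} } l := by
  have hM := h.model
  have hnd := h.nodup
  rw [hl, List.nodup_middle, List.nodup_cons] at hnd
  have hTy : ∀ y ∈ l, y ≠ x → T e ≠ some y.id := by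
    intro y hy hyx h'
    rw [hT] at h'
    exact hyx (hM.unique_id y (h.mem_graph hy) x (h.mem_graph (by rw [hl]; simp))
      (Option.some.inj h').symm)
  have hupd : ∀ y ∈ l, y ≠ x → ∀ r, RecOK P T S₀ D st.target (charState T (P e)) y r →
      RecOK P T S₀ (D ++ [e]) (Function.update st.target e.id (some r'.evt.id))
        (charState T (insert e (P e))) y r := fun y hy hyx r hr =>
    hr.update hM h.next (hM.notMem_past e h.next.mem) (hTy y hy hyx) (hne y hy hyx r hr)
  have hAl : ∀ y ∈ A, y ∈ l ∧ y ≠ x := fun y hy =>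
    ⟨by rw [hl]; simp [hy], fun hyx => hnd.1 (by simp [← hyx, hy])⟩
  have hBl : ∀ y ∈ B, y ∈ l ∧ y ≠ x := fun y hy =>
    ⟨by rw [hl]; simp [hy], fun hyx => hnd.1 (by simp [← hyx, hy])⟩
  refine ⟨h.events_eq, h.base_past.trans (Finset.subset_insert _ _), h.mem_insert, ?_, ?_,
    h.state.base_past, h.state.chain⟩
  · rw [hl]
    refine Rep.append (hA.weaken id (fun _ _ h => h)
      (fun y hy => IsAlive.update (hTy y (hAl y hy).1 (hAl y hy).2))
      fun y hy => hupd y (hAl y hy).1 (hAl y hy).2) (.record hr' ?_)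
    exact hB.weaken id (fun _ _ h => h)
      (fun y hy => IsAlive.update (hTy y (hBl y hy).1 (hBl y hy).2))
      fun y hy => hupd y (hBl y hy).1 (hBl y hy).2
  · intro d hd hdS j hj
    simp only at hj
    rcases List.mem_append.1 hd with hd | hd
    · rw [Function.update_of_ne (h.next.id_ne hM hd)] at hj
      obtain ⟨f, hf, hfe⟩ := h.state.target_mem d hd hdS _ hj
      exact ⟨f, by simp [hf], hfe⟩
    · rw [List.mem_singleton] at hd
      subst hd
      simp at hj
      exact ⟨r'.evt, hr'.evt_mem, hj⟩

/-- Applying a deletion keeps the internal state correct, and the transformed operation has the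
effect of the deletion on the document. -/
theorem applyDelete (h : Ready P T G S₀ D st l e) {k : ℕ} (he : e.op = .delete k)
    (hok : StepOK P T l e) :
    StateOK P T G S₀ (D ++ [e]) (insert e (P e)) (st.applyDelete e (P e) k).1
        (integrate R P T l e) ∧
      applyOp (docOf T l D) e.id (st.applyDelete e (P e) k).2 =
        docOf T (integrate R P T l e) (D ++ [e]) := by
  have hM := h.model
  obtain ⟨A, x, B, hl, hA, hx, hT⟩ := hok.2 k he
  have hle : k ≤ l.countP (visibleIn T (P e)) := by
    rw [hl, List.countP_append]; omega
  have hvis : ∀ x ∈ l, ∀ r, RecOK P T S₀ D st.target (charState T (P e)) x r →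
      (r.sp = 1 ↔ visibleIn T (P e) x = true) := fun x _ r hr => by simp [visibleIn, hr.sp_eq]
  obtain ⟨hs1, hs2⟩ := h.state.rep.split (fun x => h.not_visible_of_isDead)
    (fun x => h.visible_of_isAlive) hvis hle
  obtain ⟨A', hA1, hA2, hA3⟩ := splitNth_append_cons (visibleIn T (P e)) (A := A) (B := B) (x := x)
  rw [hA, ← hl] at hA1 hA2
  rw [hA2] at hs2
  have hsub : ∀ y ∈ A' ++ x :: B, y ∈ l := by
    intro y hy
    rw [hl, hA1]
    simp at hy ⊢; tauto
  obtain ⟨ht, hd⟩ := hs2.dropWhile (p := visibleIn T (P e))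
    (fun y hy => h.not_visible_of_isDead (hsub y hy))
    (fun y hy => h.visible_of_isAlive (hsub y hy)) (fun y hy => hvis y (hsub y hy)) hA3 hx
  have hbefore := hs1.append ht
  rw [← hA1] at hbefore
  have hxl : x ∈ l := by rw [hl]; simp
  have hxI := (h.mem_iff x).1 hxl
  have hex : e ≠ x := fun h => Evt.not_isInsert he (h ▸ hxI.2)
  have hcs : charState T (P e) x = 1 := by simpa [visibleIn] using hx
  have hdoc := docOf_delete (A := A) (B := B) hM h.next he hT
    (fun y hy => ((h.mem_iff y).1 (hl ▸ hy)).1) (fun y hy => ((h.mem_iff y).1 (hl ▸ hy)).2)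
    (hl ▸ h.nodup)
  rw [← hl] at hdoc
  rw [integrate_delete he, hdoc]
  have hdel : DeletedIn T (D ++ [e]) x := deletedIn_concat.2 (Or.inr ⟨hex, hT⟩)
  rcases hd with ⟨r, rest, hdw, hr, hB⟩ | ⟨n, rest, hdw, ha, hB⟩
  · simp only [State.applyDelete, hdw]
    refine ⟨h.delete_stateOK (r' := { r with sp := r.sp + 1, deleted := true }) hl hT hbefore hB
      ?_ ?_, ?_⟩
    · refine ⟨by simp [hr.evt_mem], hr.evt_notMem, hr.created, ?_, by simp [hdel], ?_, ?_⟩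
      · rw [charState_insert (hM.notMem_past e h.next.mem), if_pos hT]
        simp [hr.sp_eq]
      · intro d hd hdS
        rcases List.mem_append.1 hd with hd | hd
        · rw [Function.update_of_ne (h.next.id_ne hM hd)]
          exact hr.target_iff d hd hdS
        · rw [List.mem_singleton] at hd
          subst hd
          simp [hT]
      · simp only
        rw [Function.update_of_ne (h.next.id_ne hM hr.evt_mem)]
        exact hr.target_self
    · -- the event that created `r` has the target `x` only
      intro y hy hyx r₂ hr₂ hrr
      have h1 := (hr.target_iff r.evt hr.evt_mem hr.evt_notMem).1 hr.target_self
      have h2 := (hr₂.target_iff r.evt hr.evt_mem hr.evt_notMem).1 (hrr ▸ hr.target_self)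
      rw [h1] at h2
      exact hyx (hM.unique_id y (h.mem_graph hy) x (h.mem_graph hxl) (Option.some.inj h2).symm)
    · have := hr.deleted_iff
      by_cases hD : DeletedIn T D x
      · simp [this.2 hD, hD, applyOp]
      · have hf : r.deleted = false := by simpa [hD] using this
        simp only [hf, hD, applyOp, if_false]
        rw [if_neg (by simp)]
        simp only [h.effIndex_eq hbefore]
  · simp only [State.applyDelete, hdw]
    refine ⟨h.delete_stateOK (r' := ⟨e, P e, 2, true⟩) hl hT hbefore hB ?_ ?_, ?_⟩
    · refine ⟨by simp, h.notMem_base, fun hxS => absurd ha.1 hxS, ?_, by simp [hdel], ?_,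
        by simp⟩
      · rw [charState_insert (hM.notMem_past e h.next.mem), if_pos hT, hcs]
      · intro d hd hdS
        rcases List.mem_append.1 hd with hd | hd
        · rw [Function.update_of_ne (h.next.id_ne hM hd)]
          refine iff_of_false (fun h' => ?_) (ha.2 d hd fun hdx => hdS (hdx ▸ ha.1))
          obtain ⟨f, hf, hfe⟩ := h.state.target_mem d hd hdS _ h'
          exact h.next.id_ne hM hf hfe
        · rw [List.mem_singleton] at hd
          subst hd
          simp [hT]
    · exact fun y _ _ r hr hrr => h.next.id_ne hM hr.evt_mem hrr.symm
    · rw [if_neg (not_deletedIn_of_isAlive ha)]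
      simp only [applyOp, h.effIndex_eq hbefore]

theorem apply (h : Ready P T G S₀ D st l e) (hP : events G e.parents = P e)
    (hok : StepOK P T l e) :
    StateOK P T G S₀ (D ++ [e]) (insert e (P e)) (st.apply R G e).1 (integrate R P T l e) ∧
      applyOp (docOf T l D) e.id (st.apply R G e).2 = docOf T (integrate R P T l e) (D ++ [e]) := by
  cases he : e.op with
  | insert i c =>
    simp only [State.apply, he, hP]
    exact h.applyInsert he hok
  | delete k =>
    simp only [State.apply, he, hP]
    exact h.applyDelete he hok

end Ready

/-- An event that sees all other processed events is not transformed. -/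
theorem applyOp_of_past_eq (hM : Model P T G) {e : Evt ID C} (hn : NextEvent P G D e)
    (hDP : ∀ x ∈ D, x ∈ P e) (hl : ∀ x, x ∈ l ↔ x ∈ D ∧ x.IsInsert) (hnd : l.Nodup)
    (hok : StepOK P T l e) :
    applyOp (docOf T l D) e.id (some e.op) = docOf T (integrate R P T l e) (D ++ [e]) := by
  have hvis : ∀ x ∈ l, visibleIn T (P e) x = decide (¬ DeletedIn T D x) := by
    intro x hx
    have hx' := (hl x).1 hx
    rw [visibleIn, decide_eq_decide, hM.charState_eq_one_iff (hM.past_subset e hn.mem)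
      (hM.past_trans e hn.mem) (hn.subset x hx'.1) hx'.2]
    constructor
    · rintro ⟨-, h⟩ ⟨d, hd, hdx, hT⟩
      exact h d (hDP d hd) hdx hT
    · exact fun h => ⟨hDP x hx'.1, fun d hd hdx hT => h ⟨d, hn.past d hd, hdx, hT⟩⟩
  cases he : e.op with
  | insert i c =>
    have happ := splitNth_append (visibleIn T (P e)) i l
    have hcount := countP_splitNth (visibleIn T (P e)) (hok.1 i c he)
    simp only [integrate, he, applyOp]
    set A := (splitNth (visibleIn T (P e)) i l).1
    set B := (splitNth (visibleIn T (P e)) i l).2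
    have hrun : (B.takeWhile fun x => decide (x ∉ P e)) = [] := by
      cases hB : B with
      | nil => rfl
      | cons b B' =>
        have : b ∈ l := by rw [← happ, hB]; simp
        simp [hDP b ((hl b).1 this).1]
    rw [hrun]
    simp only [List.map_nil, List.length_nil, Nat.min_zero, List.take_zero, List.append_nil,
      List.drop_zero]
    rw [docOf_insert hM hn he (fun x hx => ((hl x).1 (happ ▸ hx)).1)
      (fun x hx => ((hl x).1 (happ ▸ hx)).2), happ, ← hcount]
    congr 1
    exact List.countP_congr fun x hx => by
      rw [hvis x (happ ▸ List.mem_append_left _ hx)]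
  | delete k =>
    obtain ⟨A, x, B, hl', hA, hx, hT⟩ := hok.2 k he
    subst hl'
    rw [integrate_delete he, docOf_delete hM hn he hT (fun x hx => ((hl x).1 hx).1)
      (fun x hx => ((hl x).1 hx).2) hnd]
    rw [hvis x (by simp)] at hx
    rw [if_neg (by simpa using hx)]
    simp only [applyOp]
    rw [← hA]
    congr 1
    exact List.countP_congr fun y hy => by rw [hvis y (by simp [hy])]

/-- The state after clearing is correct. -/
theorem StateOK.cleared {V : Finset ID} (hV : events G V = D.toFinset)
    (hcrit : ∀ b ∈ G, b ∉ D → ∀ x ∈ D, x ∈ P b) (hl : ∀ x ∈ l, x ∈ D) :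
    StateOK P T G D.toFinset D D.toFinset (State.cleared V) l := by
  refine ⟨hV, subset_rfl, by simp, Rep.all_top trivial fun x hx => ?_, ?_, ?_, ?_⟩
  · by_cases h : ∃ d ∈ D, d ≠ x ∧ T d = some x.id
    · obtain ⟨d, hd, h⟩ := h
      exact Or.inl ⟨by simp [hl x hx], d, by simp [hd], h⟩
    · push Not at h
      exact Or.inr ⟨by simp [hl x hx], h⟩
  · intro d hd hdS
    simp [hd] at hdS
  · intro b hb hbS x hx
    exact hcrit b hb (by simpa using hbS) x (by simpa using hx)
  · exact (List.pairwise_of_forall_mem_list fun x hx y hy _ => by simp [hl y hy]).isChain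

/-- A replay represents the abstract replay, whatever the policy. -/
theorem walk_correct (hG : WellFormed G) (hM : Model P T G)
    (hP : ∀ e ∈ G, events G e.parents = P e) (pol : ClearingPolicy ID C) {es : List (Evt ID C)}
    (hes : TopFrom G P ∅ es)
    (hok : ∀ u e v, es = u ++ e :: v → StepOK P T (order R P T u) e) :
    (walk R pol G es).done = es ∧
      (walk R pol G es).doc = docOf T (order R P T es) es ∧
      ∃ S₀ Q, StateOK P T G S₀ es Q (walk R pol G es).state (order R P T es) ∧
        (∀ x ∈ S₀, x ∈ es) ∧ (pol = .never → S₀ = ∅) := by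
  induction es using List.reverseRecOn with
  | nil =>
    refine ⟨rfl, rfl, ∅, ∅, ⟨events_empty G, subset_rfl, by simp, .nil, by simp, by simp, ?_⟩,
      by simp, fun _ => rfl⟩
    simp [order]
  | append_singleton es e ih =>
    obtain ⟨hes', heG, heD, hpast, -⟩ := topFrom_append.1 hes
    obtain ⟨hdone, hdoc, S₀, Q, hst, hS, hnever⟩ := ih hes' fun u e' v h =>
      hok u e' (v ++ [e]) (by simp [h])
    have hn : NextEvent P G es e := ⟨fun x hx => (hes'.mem hx).1,
      fun x hx y hy => hes'.past_subset hx hy, hes'.nodup, heG, by simpa using heD,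
      by simpa using hpast⟩
    have hmem : ∀ x, x ∈ order R P T es ↔ x ∈ es ∧ x.IsInsert := fun x => mem_order
    have hnd := order_nodup (R := R) (P := P) (T := T) hes'.nodup
    have hoke := hok es e [] (by simp)
    have heS : e ∉ S₀ := fun h => hn.notMem (hS e h)
    have hwalk : walk R pol G (es ++ [e]) = (walk R pol G es).step R pol G e := by simp [walk]
    have hev : events G {e.id} = insert e (P e) := by rw [hG.events_singleton heG, hP e heG]
    have hDC : DownClosed G (es ++ [e]).toFinset := by
      refine ⟨fun x hx => (hes.mem (List.mem_toFinset.1 hx)).1, fun x hx y hy => ?_⟩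
      rw [List.mem_toFinset] at hx ⊢
      rw [hP x (hes.mem hx).1] at hy
      exact hes.past_subset hx hy
    have hl' : ∀ x ∈ order R P T (es ++ [e]), x ∈ es ++ [e] := fun x hx => (mem_order.1 hx).1
    -- a critical version of the processed events allows clearing
    have hclear : ∀ V, events G V = (es ++ [e]).toFinset → IsCritical G V →
        StateOK P T G (es ++ [e]).toFinset (es ++ [e]) (es ++ [e]).toFinset (State.cleared V)
          (order R P T (es ++ [e])) := by
      intro V hV hcrit
      refine StateOK.cleared hV (fun b hb hbD x hx => ?_) hl'
      rw [← hP b hb, mem_past hb]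
      refine hcrit x (by rw [hV]; exact List.mem_toFinset.2 hx) b hb ?_
      rw [hV, List.mem_toFinset]
      exact hbD
    rw [hwalk, order_concat]
    rw [order_concat] at hclear
    simp only [Walk.step, hdone]
    split_ifs with hb hc
    · -- `e` is critical, so that no processed event is concurrent to `e`
      have hDP : ∀ x ∈ es, x ∈ P e := by
        intro x hx
        by_contra hxP
        have hxG := (hes'.mem hx).1
        have hex : HappenedBefore G e x := hb.2.1 e (by rw [hev]; simp) x hxG (by
          rw [hev, Finset.mem_insert, not_or]
          exact ⟨fun h => hn.notMem (h ▸ hx), hxP⟩)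
        rw [← mem_past hxG, hP x hxG] at hex
        exact hn.notMem (hes'.past_subset hx hex)
      have hevD : events G {e.id} = (es ++ [e]).toFinset := by
        rw [hev]
        ext x
        simp only [Finset.mem_insert, List.mem_toFinset, List.mem_append, List.mem_singleton]
        have := hDP x
        have := hn.past x
        tauto
      refine ⟨rfl, ?_, _, _, hclear _ hevD hb.2.1, fun x hx => List.mem_toFinset.1 hx, fun h => ?_⟩
      · rw [hdoc]
        exact applyOp_of_past_eq hM hn hDP hmem hnd hoke
      · subst h
        exact hb.1.elim
    · have hready : Ready P T G S₀ es ((walk R pol G es).state.prepare G es e.parents)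
          (order R P T es) e := ⟨hM, hn, heS, hst.prepare hn (hP e heG) heS, hmem, hnd, hev⟩
      have := hready.apply (R := R) (hP e heG) hoke
      refine ⟨rfl, by rw [hdoc]; exact this.2, _, _, hclear _ (hG.events_version hDC) hc.2,
        fun x hx => List.mem_toFinset.1 hx, fun h => ?_⟩
      subst h
      exact hc.1.elim
    · have hready : Ready P T G S₀ es ((walk R pol G es).state.prepare G es e.parents)
          (order R P T es) e := ⟨hM, hn, heS, hst.prepare hn (hP e heG) heS, hmem, hnd, hev⟩
      have := hready.apply (R := R) (hP e heG) hoke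
      exact ⟨rfl, by rw [hdoc]; exact this.2, S₀, _, this.1, fun x hx => by simp [hS x hx], hnever⟩

theorem StateOK.recordIds_eq (h : StateOK P T G ∅ D Q st l) :
    recordIds st.items = l.map Evt.id := by
  generalize hs : st.items = s
  have hr := h.rep
  rw [hs] at hr
  clear hs h
  induction hr with
  | nil => rfl
  | top => rfl
  | dead hx => exact absurd hx.1 (by simp)
  | one hx => exact absurd hx.1 (by simp)
  | succ hx => exact absurd hx.1 (by simp)
  | record hx _ ih => simpa [recordIds, (hx.created (by simp)).1] using ih

end Internal

/-! ### Targets in valid event graphs -/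

/-- The ID of the character that `e` inserts or deletes, if `f` is the replay function. -/
def targetOf (f : EventGraph ID C → Doc ID C) (G : EventGraph ID C) (e : Evt ID C) : Option ID :=
  match e.op with
  | .insert _ _ => some e.id
  | .delete k => ((f (events G e.parents))[k]?).map Prod.fst

/-- The past of an event in `G`. -/
abbrev pastOf (G : EventGraph ID C) (e : Evt ID C) : EventGraph ID C := events G e.parents

theorem mem_applyOp {doc : Doc ID C} {id : ID} {op : Option (Op C)} {p : ID × C}
    (h : p ∈ applyOp doc id op) : p ∈ doc ∨ p.1 = id := by
  match op with
  | none => exact Or.inl h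
  | some (.insert i c) =>
    rcases List.eq_or_mem_of_mem_insertIdx h with rfl | h
    · exact Or.inr rfl
    · exact Or.inl h
  | some (.delete i) => exact Or.inl (List.mem_of_mem_eraseIdx h)

/-- Every entry of a replayed document has the ID of a processed event. -/
theorem mem_walk_doc {R : IntegrationRule ID C} {pol : ClearingPolicy ID C} {G : EventGraph ID C}
    {es : List (Evt ID C)} {p : ID × C} (h : p ∈ (walk R pol G es).doc) :
    ∃ e ∈ es, e.id = p.1 := by
  induction es using List.reverseRecOn with
  | nil => simp [walk] at h
  | append_singleton es e ih =>
    have : walk R pol G (es ++ [e]) = (walk R pol G es).step R pol G e := by simp [walk]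
    rw [this] at h
    have h' : p ∈ (walk R pol G es).doc ∨ p.1 = e.id := by
      simp only [Walk.step] at h
      split_ifs at h <;> exact mem_applyOp h
    rcases h' with h | h
    · obtain ⟨e', he', hid⟩ := ih h
      exact ⟨e', by simp [he'], hid⟩
    · exact ⟨e, by simp, h.symm⟩

theorem TopFrom.congr {G G' : EventGraph ID C} {P P' : Evt ID C → EventGraph ID C}
    {S : Set (Evt ID C)} {es : List (Evt ID C)} (h : TopFrom G P S es)
    (hes : ∀ e ∈ es, e ∈ G' ∧ P' e = P e) : TopFrom G' P' S es := by
  induction es generalizing S with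
  | nil => trivial
  | cons a es ih =>
    obtain ⟨h1, h2⟩ := hes a (by simp)
    exact ⟨h1, h.2.1, h2 ▸ h.2.2.1, ih h.2.2.2 fun e he => hes e (by simp [he])⟩

theorem Model.restrict {G H : EventGraph ID C} {T : Evt ID C → Option ID}
    (h : Model (pastOf G) T G) (hH : DownClosed G H) : Model (pastOf G) T H where
  unique_id a ha b hb := h.unique_id a (hH.1 ha) b (hH.1 hb)
  past_subset e he := hH.2 e he
  past_trans e he := h.past_trans e (hH.1 he)
  notMem_past e he := h.notMem_past e (hH.1 he)
  target_insert e he := h.target_insert e (hH.1 he)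
  target_mem d hd x hx := h.target_mem d (hH.1 hd) x (hH.1 hx)

section Convergence

variable {R : IntegrationRule ID C} {sort : EventGraph ID C → List (Evt ID C)}
  {G : EventGraph ID C}

theorem sort_topFrom (hsort : IsSorter sort) (hG : WellFormed G) {H : EventGraph ID C}
    (hH : DownClosed G H) :
    TopFrom H (pastOf G) ∅ (sort H) ∧ ∀ x, x ∈ sort H ↔ x ∈ H := by
  have hHw := hH.wellFormed hG
  have ht := hsort H hHw.exists_isTopSort
  refine ⟨(ht.topFrom hHw).congr fun e he => ?_, ht.mem_iff⟩
  have := (ht.mem_iff e).1 he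
  exact ⟨this, (hH.past_eq this).symm⟩

theorem model_targetOf (hsort : IsSorter sort) (hG : WellFormed G) (pol : ClearingPolicy ID C) :
    Model (pastOf G) (targetOf (replay R pol sort) G) G where
  unique_id := hG.unique_id
  past_subset _ _ := events_subset _ _
  past_trans e he x hx := past_trans he hx
  notMem_past e he := hG.notMem_past he
  target_insert e _ h := by
    obtain ⟨i, c, h⟩ := h
    simp [targetOf, h]
  target_mem d hd x hx hdx hT := by
    rcases d.isInsert_or_delete with ⟨i, c, h⟩ | ⟨k, h⟩
    · simp only [targetOf, h, Option.some.injEq] at hT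
      exact absurd (hG.unique_id d hd x hx hT) hdx
    · simp only [targetOf, h, Option.map_eq_some_iff] at hT
      obtain ⟨p, hp, hpx⟩ := hT
      obtain ⟨y, hy, hyp⟩ := mem_walk_doc (List.mem_of_getElem? hp)
      have hy' := ((sort_topFrom hsort hG (downClosed_past hd)).2 y).1 hy
      rwa [← hG.unique_id y (events_subset _ _ hy') x hx (hyp.trans hpx)]

/-- Replaying a downward closed subgraph gives the document of the abstract replay. -/
theorem replay_eq_docOf {T : Evt ID C → Option ID} (hsort : IsSorter sort) (hG : WellFormed G)
    (hM : Model (pastOf G) T G) (pol : ClearingPolicy ID C) {H : EventGraph ID C}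
    (hH : DownClosed G H)
    (hok : ∀ u e, u.length < H.card → TopFrom G (pastOf G) ∅ (u ++ [e]) →
      StepOK (pastOf G) T (order R (pastOf G) T u) e) :
    replay R pol sort H = docOf T (order R (pastOf G) T (sort H)) (sort H) := by
  obtain ⟨htop, hmem⟩ := sort_topFrom hsort hG hH
  refine (walk_correct (hH.wellFormed hG) (hM.restrict hH) (fun e he => hH.past_eq he) pol htop
    fun u e v h => ?_).2.1
  refine hok u e ?_ ?_
  · have hlen : (sort H).length = H.card := by
      rw [← List.toFinset_card_of_nodup htop.nodup]
      congr 1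
      ext x
      simp [hmem x]
    have := congrArg List.length h
    simp at this
    omega
  · rw [h, show u ++ e :: v = (u ++ [e]) ++ v by simp, topFrom_append] at htop
    refine htop.1.congr fun e' he' => ⟨hH.1 ((hmem e').1 ?_), rfl⟩
    rw [h]
    simp at he' ⊢; tauto

/-- If the abstract replay converges, then an event sees the same document in it as in the replay
of its past. -/
theorem visible_entries_eq {T : Evt ID C → Option ID} (hsort : IsSorter sort) (hG : WellFormed G)
    (hM : Model (pastOf G) T G) (pol : ClearingPolicy ID C) {n : ℕ}
    (hswap : SwapBelow R (pastOf G) T G n)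
    (hok : ∀ u e, u.length < n → TopFrom G (pastOf G) ∅ (u ++ [e]) →
      StepOK (pastOf G) T (order R (pastOf G) T u) e)
    {u : List (Evt ID C)} {e : Evt ID C} (hu : u.length ≤ n)
    (htop : TopFrom G (pastOf G) ∅ (u ++ [e])) :
    replay R pol sort (pastOf G e) =
      ((order R (pastOf G) T u).filter (visibleIn T (pastOf G e))).filterMap Evt.entry := by
  obtain ⟨htopu, heG, heu, hpast, -⟩ := topFrom_append.1 htop
  have hH := downClosed_past heG
  have hpast' : ∀ x ∈ pastOf G e, x ∈ u := by simpa using hpast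
  have hcard : (pastOf G e).card ≤ u.length := by
    rw [← List.toFinset_card_of_nodup htopu.nodup]
    exact Finset.card_le_card fun x hx => List.mem_toFinset.2 (hpast' x hx)
  obtain ⟨hs, hmem⟩ := sort_topFrom hsort hG hH
  have hs' : TopFrom G (pastOf G) ∅ (sort (pastOf G e)) :=
    hs.congr fun x hx => ⟨hH.1 ((hmem x).1 hx), rfl⟩
  rw [replay_eq_docOf hsort hG hM pol hH fun u' e' h => hok u' e' (h.trans_le (hcard.trans hu)),
    docOf]
  congr 1
  set s := sort (pastOf G e)
  have h1 : order R (pastOf G) T u =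
      order R (pastOf G) T (s ++ u.filter fun x => decide (x ∉ s)) := by
    refine hswap.order_congr hu htopu (hs'.append_filter htopu) fun x => ?_
    simp only [List.mem_append, List.mem_filter, decide_eq_true_eq]
    have := hpast' x
    have := hmem x
    tauto
  rw [h1, order_append, foldl_integrate_filter]
  · refine List.filter_congr fun x hx => ?_
    obtain ⟨hxs, hxI⟩ := mem_order.1 hx
    rw [visibleIn, decide_eq_decide, hM.charState_eq_one_iff hH.1 hH.2
      (hs'.mem hxs).1 hxI]
    constructor
    · exact fun h => ⟨(hmem x).1 hxs, fun d hd hdx hT => h ⟨d, (hmem d).2 hd, hdx, hT⟩⟩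
    · rintro ⟨-, h⟩ ⟨d, hd, hdx, hT⟩
      exact h d ((hmem d).1 hd) hdx hT
  · intro x hx
    simp only [List.mem_filter, decide_eq_true_eq] at hx
    simp only [visibleIn, decide_eq_false_iff_not]
    intro h
    refine hx.2 ((hmem x).2 (hM.mem_of_charState_ne_zero hH.1 hH.2 (htopu.mem hx.1).1
      (ne_of_eq_of_ne h one_ne_zero)))

theorem stepOK_of_swapBelow (hsort : IsSorter sort)
    (hG : Valid (replay R .never sort) G) {n : ℕ}
    (hswap : SwapBelow R (pastOf G) (targetOf (replay R .never sort) G) G n)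
    (hok : ∀ u e, u.length < n → TopFrom G (pastOf G) ∅ (u ++ [e]) →
      StepOK (pastOf G) (targetOf (replay R .never sort) G)
        (order R (pastOf G) (targetOf (replay R .never sort) G) u) e)
    {u : List (Evt ID C)} {e : Evt ID C} (hu : u.length ≤ n)
    (htop : TopFrom G (pastOf G) ∅ (u ++ [e])) :
    StepOK (pastOf G) (targetOf (replay R .never sort) G)
        (order R (pastOf G) (targetOf (replay R .never sort) G) u) e := by
  have hM := model_targetOf (R := R) hsort hG.wellFormed .never
  have heG : e ∈ G := (topFrom_append.1 htop).2.1
  have hdoc := visible_entries_eq hsort hG.wellFormed hM .never hswap hok hu htop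
  have hI : ∀ x ∈ (order R (pastOf G) (targetOf (replay R .never sort) G) u).filter
      (visibleIn (targetOf (replay R .never sort) G) (pastOf G e)), x.IsInsert := fun x hx =>
    (mem_order.1 (List.mem_filter.1 hx).1).2
  have hb := hG.inBounds e heG
  have hlen := congrArg List.length hdoc
  rw [length_filterMap_entry hI, ← List.countP_eq_length_filter] at hlen
  rw [show events G e.parents = pastOf G e from rfl, hlen] at hb
  refine ⟨fun i c he => by simpa [he, Op.InBounds] using hb, fun k he => ?_⟩
  rw [he] at hb
  obtain ⟨A, x, B, h1, h2, h3, h4⟩ := exists_split_of_lt_countP _ hb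
  refine ⟨A, x, B, h1, h2, h3, ?_⟩
  obtain ⟨i, c, hx⟩ := hI x (List.mem_of_getElem? h4)
  simp only [targetOf, he]
  rw [show events G e.parents = pastOf G e from rfl, hdoc, getElem?_filterMap_entry hI, h4]
  simp [Evt.entry, hx]

/-- Only swapping two insertions matters. -/
theorem swapBelow_of_insert {P : Evt ID C → EventGraph ID C} {T : Evt ID C → Option ID} {n : ℕ}
    (h : ∀ es a b, (es ++ [a, b]).length ≤ n → TopFrom G P ∅ (es ++ [a, b]) → a ∉ P b →
      a.IsInsert → b.IsInsert → order R P T (es ++ [a, b]) = order R P T (es ++ [b, a])) :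
    SwapBelow R P T G n := by
  intro es a b hlen htop hab
  have h2 : ∀ x y, order R P T (es ++ [x, y]) =
      integrate R P T (integrate R P T (order R P T es) x) y := by
    intro x y
    rw [order_append]; rfl
  rcases a.isInsert_or_delete with ha | ⟨k, ha⟩
  · rcases b.isInsert_or_delete with hb | ⟨k, hb⟩
    · exact h es a b hlen htop hab ha hb
    · rw [h2, h2, integrate_delete hb, integrate_delete hb]
  · rw [h2, h2, integrate_delete ha, integrate_delete ha]

/-- If concurrent insertions commute as long as all events see the documents in which they were
generated, then they always commute, and all events see these documents. -/
theorem convergence (hsort : IsSorter sort) (hG : Valid (replay R .never sort) G)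
    (hstep : ∀ n, (∀ u e, u.length < n → TopFrom G (pastOf G) ∅ (u ++ [e]) →
        StepOK (pastOf G) (targetOf (replay R .never sort) G)
          (order R (pastOf G) (targetOf (replay R .never sort) G) u) e) →
      SwapBelow R (pastOf G) (targetOf (replay R .never sort) G) G n) (n : ℕ) :
    (∀ u e, u.length < n → TopFrom G (pastOf G) ∅ (u ++ [e]) →
        StepOK (pastOf G) (targetOf (replay R .never sort) G)
          (order R (pastOf G) (targetOf (replay R .never sort) G) u) e) ∧
      SwapBelow R (pastOf G) (targetOf (replay R .never sort) G) G n := by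
  suffices h : ∀ u e, u.length < n → TopFrom G (pastOf G) ∅ (u ++ [e]) →
        StepOK (pastOf G) (targetOf (replay R .never sort) G)
          (order R (pastOf G) (targetOf (replay R .never sort) G) u) e from ⟨h, hstep n h⟩
  induction n with
  | zero => intro u e h; simp at h
  | succ n ih =>
    exact fun u e hu htop => stepOK_of_swapBelow hsort hG (hstep n ih) ih (by omega) htop

/-- Without clearing, the records are those of the abstract sequence. -/
theorem recordIds_walk_never {T : Evt ID C → Option ID} (hG : WellFormed G)
    (hM : Model (pastOf G) T G) {es : List (Evt ID C)} (hes : TopFrom G (pastOf G) ∅ es)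
    (hok : ∀ u e, u.length < es.length → TopFrom G (pastOf G) ∅ (u ++ [e]) →
      StepOK (pastOf G) T (order R (pastOf G) T u) e) :
    recordIds (walk R .never G es).state.items = (order R (pastOf G) T es).map Evt.id := by
  obtain ⟨-, -, S₀, Q, hst, -, h0⟩ := walk_correct (R := R) hG hM (fun e _ => rfl) .never hes
    fun u e v h => by
      subst h
      refine hok u e (by simp) ?_
      rw [show u ++ e :: v = (u ++ [e]) ++ v by simp, topFrom_append] at hes
      exact hes.1
  rw [h0 rfl] at hst
  exact hst.recordIds_eq

theorem eq_of_map_id_eq (hG : WellFormed G) {l l' : List (Evt ID C)} (hl : ∀ x ∈ l, x ∈ G)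
    (hl' : ∀ x ∈ l', x ∈ G) (h : l.map Evt.id = l'.map Evt.id) : l = l' := by
  induction l generalizing l' with
  | nil => simpa using h.symm
  | cons a l ih =>
    cases l' with
    | nil => simp at h
    | cons b l' =>
      simp only [List.map_cons, List.cons.injEq] at h
      rw [hG.unique_id a (hl a (by simp)) b (hl' b (by simp)) h.1,
        ih (fun x hx => hl x (by simp [hx])) (fun x hx => hl' x (by simp [hx])) h.2]

/-- The swap property of a list CRDT carries over to the abstract replay. -/
theorem IntegrationRule.IsListCRDT.swapBelow (hR : R.IsListCRDT) (hsort : IsSorter sort)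
    (hG : Valid (replay R .never sort) G) (n : ℕ)
    (hok : ∀ u e, u.length < n → TopFrom G (pastOf G) ∅ (u ++ [e]) →
        StepOK (pastOf G) (targetOf (replay R .never sort) G)
          (order R (pastOf G) (targetOf (replay R .never sort) G) u) e) :
    SwapBelow R (pastOf G) (targetOf (replay R .never sort) G) G n := by
  refine swapBelow_of_insert fun es a b hlen htop hab ha hb => ?_
  have hM := model_targetOf (R := R) hsort hG.wellFormed .never
  have htop' := topFrom_swap (w := []) htop hab
  obtain ⟨g, hg⟩ := hG.wellFormed.exists_isTopSort
  have hrest := htop.append_filter (hg.topFrom hG.wellFormed)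
  set rest := g.filter fun x => decide (x ∉ es ++ [a, b]) with hrest_def
  have hcrdt := hR sort hsort G hG es a b rest (by
      rw [show es ++ a :: b :: rest = (es ++ [a, b]) ++ rest by simp]
      refine hrest.isTopSort fun x hx => ?_
      by_cases hxm : x ∈ es ++ [a, b]
      · exact List.mem_append_left _ hxm
      · refine List.mem_append_right _ (List.mem_filter.2 ⟨(hg.mem_iff x).2 hx, ?_⟩)
        simpa using hxm)
    (fun h => hab ((mem_past h.right_mem).2 h)) ha hb
  rw [recordIds_walk_never hG.wellFormed hM htop fun u e hu => hok u e (by omega),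
    recordIds_walk_never hG.wellFormed hM htop' fun u e hu => hok u e (by
      simp at hlen hu; omega)] at hcrdt
  exact eq_of_map_id_eq hG.wellFormed (fun x hx => (htop.mem (mem_order.1 hx).1).1)
    (fun x hx => (htop'.mem (mem_order.1 hx).1).1) hcrdt

end Convergence

/-! ### RGA is a list CRDT -/

/-- Insertion in front of the first smaller element. -/
def insertBefore {α : Type*} (lt : α → α → Prop) (x : α) : List α → List α
  | [] => [x]
  | c :: l => if lt x c then c :: insertBefore lt x l else x :: c :: l

section InsertBefore

variable {α : Type*} {lt : α → α → Prop}

theorem insertBefore_eq (x : α) (l : List α) :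
    insertBefore lt x l =
      (l.takeWhile fun c => decide (lt x c)) ++ x :: l.dropWhile fun c => decide (lt x c) := by
  induction l with
  | nil => rfl
  | cons c l ih =>
    by_cases h : lt x c
    · simp [insertBefore, h, ih]
    · simp [insertBefore, h]

theorem insertBefore_comm_of_lt (htrans : ∀ a b c, lt a b → lt b c → lt a c) {a b : α}
    (hab : lt a b) (hba : ¬ lt b a) (l : List α) :
    insertBefore lt a (insertBefore lt b l) = insertBefore lt b (insertBefore lt a l) := by
  induction l with
  | nil => simp [insertBefore, hab, hba]
  | cons c l ih =>
    by_cases hbc : lt b c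
    · simp [insertBefore, hbc, htrans a b c hab hbc, ih]
    · by_cases hac : lt a c
      · simp [insertBefore, hbc, hac, hab]
      · simp [insertBefore, hbc, hac, hab, hba]

/-- Whether an element is inserted inside of a prefix does not depend on the remaining list. -/
theorem insertBefore_append (a : α) (B : List α) :
    (∃ B₁ B₂, B = B₁ ++ B₂ ∧ B₂ ≠ [] ∧
      ∀ l, insertBefore lt a (B ++ l) = B₁ ++ a :: B₂ ++ l) ∨
    ∀ l, insertBefore lt a (B ++ l) = B ++ insertBefore lt a l := by
  induction B with
  | nil => exact Or.inr fun l => rfl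
  | cons c B ih =>
    by_cases h : lt a c
    · rcases ih with ⟨B₁, B₂, rfl, h2, h3⟩ | ih
      · refine Or.inl ⟨c :: B₁, B₂, rfl, h2, fun l => ?_⟩
        simp only [List.cons_append, insertBefore, h, if_true, h3]
      · refine Or.inr fun l => ?_
        simp only [List.cons_append, insertBefore, h, if_true, ih]
    · refine Or.inl ⟨[], c :: B, rfl, by simp, fun l => ?_⟩
      simp [insertBefore, h]

/-- Insertion in front of the first smaller element after the `i`th element that satisfies `p`. -/
def insertAfterNth (lt : α → α → Prop) (p : α → Bool) (i : ℕ) (x : α) (l : List α) : List α :=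
  (splitNth p i l).1 ++ insertBefore lt x (splitNth p i l).2

/-- The case of `insertAfterNth_comm` in which `a` starts its search first. -/
theorem insertAfterNth_comm_of_append (htrans : ∀ a b c, lt a b → lt b c → lt a c) {a b : α}
    (hab : lt a b ∧ ¬ lt b a ∨ lt b a ∧ ¬ lt a b) {p q : α → Bool} {i j : ℕ} {l B : List α}
    (hi : i ≤ l.countP p) (hj : j ≤ l.countP q) (hqa : q a = false)
    (hB : (splitNth q j l).1 = (splitNth p i l).1 ++ B) :
    insertAfterNth lt q j b (insertAfterNth lt p i a l) =
      insertAfterNth lt p i a (insertAfterNth lt q j b l) := by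
  have hp := splitNth_prefix p hi
  have hq := splitNth_prefix q hj
  have hl := splitNth_append p i l
  have hl' := splitNth_append q j l
  have hlast := splitNth_last q hj
  have hcount := countP_splitNth q hj
  simp only [insertAfterNth]
  set A := (splitNth p i l).1
  set L := (splitNth q j l).2
  rw [hB] at hq hl' hlast hcount ⊢
  have hA2 : (splitNth p i l).2 = B ++ L := by
    rw [← hl, List.append_assoc] at hl'
    exact (List.append_cancel_left hl').symm
  rw [hA2]
  rw [List.append_assoc A B (insertBefore lt b L), hp]
  rcases insertBefore_append (lt := lt) a B with ⟨B₁, B₂, rfl, hne, h⟩ | h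
  · rw [h, h]
    have hsplit : splitNth q j (A ++ (B₁ ++ a :: B₂ ++ L)) = (A ++ (B₁ ++ a :: B₂), L) := by
      rcases hlast with ⟨-, h0⟩ | ⟨X, o, hX, ho⟩
      · simp at h0; exact absurd h0.2.2 hne
      · have hB₂ : ∃ Y, B₂ = Y ++ [o] := by
          refine ⟨B₂.dropLast, ?_⟩
          have h1 := congrArg List.getLast? hX
          simp only [List.getLast?_append, List.getLast?_singleton] at h1
          rw [List.getLast?_eq_some_getLast hne] at h1
          simp at h1
          rw [← h1, List.dropLast_append_getLast]
        obtain ⟨Y, rfl⟩ := hB₂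
        have hc : (A ++ (B₁ ++ a :: Y) ++ [o]).countP q = j := by
          rw [← hcount]
          simp [List.countP_append, List.countP_cons, hqa]
        have := splitNth_of_last q (A := A ++ (B₁ ++ a :: Y)) (B := L) ho
        rw [hc] at this
        simpa using this
    rw [hsplit]
    simp
  · rw [h, h, ← List.append_assoc, hq]
    rcases hab with hab | hab
    · rw [insertBefore_comm_of_lt htrans hab.1 hab.2, List.append_assoc]
    · rw [insertBefore_comm_of_lt htrans hab.1 hab.2, List.append_assoc]

theorem insertAfterNth_comm (htrans : ∀ a b c, lt a b → lt b c → lt a c) {a b : α}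
    (hab : lt a b ∧ ¬ lt b a ∨ lt b a ∧ ¬ lt a b) {p q : α → Bool} {i j : ℕ} {l : List α}
    (hi : i ≤ l.countP p) (hj : j ≤ l.countP q) (hqa : q a = false) (hpb : p b = false) :
    insertAfterNth lt q j b (insertAfterNth lt p i a l) =
      insertAfterNth lt p i a (insertAfterNth lt q j b l) := by
  have h1 : (splitNth p i l).1 <+: l := ⟨_, splitNth_append p i l⟩
  have h2 : (splitNth q j l).1 <+: l := ⟨_, splitNth_append q j l⟩
  rcases List.prefix_or_prefix_of_prefix h1 h2 with ⟨B, hB⟩ | ⟨B, hB⟩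
  · exact insertAfterNth_comm_of_append htrans hab hi hj hqa hB.symm
  · exact (insertAfterNth_comm_of_append htrans hab.symm hj hi hpb hB.symm).symm

end InsertBefore

section Rga

variable [LinearOrder ID]

theorem InsertOp.TimestampLT.trans {a b c : InsertOp ID C} (h : a.TimestampLT b)
    (h' : b.TimestampLT c) : a.TimestampLT c := by
  unfold InsertOp.TimestampLT at *
  rcases h with h | ⟨h1, h2⟩ <;> rcases h' with h' | ⟨h3, h4⟩
  · exact Or.inl (h.trans h')
  · exact Or.inl (h3 ▸ h)
  · exact Or.inl (h1 ▸ h')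
  · exact Or.inr ⟨h1.trans h3, h2.trans h4⟩

theorem InsertOp.TimestampLT.irrefl {a : InsertOp ID C} (h : a.TimestampLT a) : False := by
  unfold InsertOp.TimestampLT at h
  rcases h with h | ⟨-, h⟩ <;> exact lt_irrefl _ h

theorem InsertOp.timestampLT_or {a b : InsertOp ID C} (h : a.evt.id ≠ b.evt.id) :
    a.TimestampLT b ∨ b.TimestampLT a := by
  unfold InsertOp.TimestampLT
  rcases lt_trichotomy a.past.card b.past.card with h1 | h1 | h1
  · exact Or.inl (Or.inl h1)
  · rcases lt_or_gt_of_ne h with h2 | h2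
    · exact Or.inl (Or.inr ⟨h1, h2⟩)
    · exact Or.inr (Or.inr ⟨h1.symm, h2⟩)
  · exact Or.inr (Or.inl h1)

/-- Events in the past of `e` have smaller timestamps, so that RGA never skips them. Hence the
search for the insertion position need not be limited to the run of `NotInsertedYet` records. -/
theorem integrate_rga {G : EventGraph ID C} {P : Evt ID C → EventGraph ID C}
    {T : Evt ID C → Option ID} (hM : Model P T G) {e : Evt ID C} (heG : e ∈ G)
    {i : ℕ} {c : C} (he : e.op = .insert i c) (l : List (Evt ID C)) :
    integrate (rga ID C) P T l e =
      insertAfterNth (fun x y => InsertOp.TimestampLT ⟨x, P x⟩ ⟨y, P y⟩) (visibleIn T (P e)) i e l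
      := by
  have hpast : ∀ x, InsertOp.TimestampLT ⟨e, P e⟩ ⟨x, P x⟩ → x ∉ P e := by
    intro x hlt hx
    have : (P x).card < (P e).card := Finset.card_lt_card ⟨hM.past_trans e heG x hx,
      fun h => hM.notMem_past x (hM.past_subset e heG hx) (h hx)⟩
    rcases hlt with h | h
    · exact absurd h (by simp; omega)
    · exact absurd h.1 (by simp; omega)
  simp only [integrate, he, insertAfterNth, insertBefore_eq, rga]
  set A := (splitNth (visibleIn T (P e)) i l).1
  set B := (splitNth (visibleIn T (P e)) i l).2
  have hk : min (((B.takeWhile fun x => decide (x ∉ P e)).map fun x =>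
        (⟨x, P x⟩ : InsertOp ID C)).takeWhile fun r =>
          decide (InsertOp.TimestampLT ⟨e, P e⟩ r)).length
        (B.takeWhile fun x => decide (x ∉ P e)).length =
      (B.takeWhile fun x => decide (InsertOp.TimestampLT ⟨e, P e⟩ ⟨x, P x⟩)).length := by
    rw [List.takeWhile_map, List.length_map, List.takeWhile_takeWhile]
    have : (fun a => decide (((fun r => decide (InsertOp.TimestampLT ⟨e, P e⟩ r)) ∘
        fun x => (⟨x, P x⟩ : InsertOp ID C)) a = true ∧ decide (a ∉ P e) = true)) =
        fun x => decide (InsertOp.TimestampLT ⟨e, P e⟩ ⟨x, P x⟩) := by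
      funext x
      rw [decide_eq_decide]
      simp only [Function.comp, decide_eq_true_eq]
      exact ⟨fun h => h.1, fun h => ⟨h, hpast x h⟩⟩
    rw [this, min_eq_left]
    rw [← this, ← List.takeWhile_takeWhile]
    exact (List.takeWhile_prefix _).length_le
  rw [hk]
  have h1 := List.takeWhile_append_dropWhile
    (p := fun x => decide (InsertOp.TimestampLT ⟨e, P e⟩ ⟨x, P x⟩)) (l := B)
  have htake : B.take (B.takeWhile fun x =>
      decide (InsertOp.TimestampLT ⟨e, P e⟩ ⟨x, P x⟩)).length =
      B.takeWhile fun x => decide (InsertOp.TimestampLT ⟨e, P e⟩ ⟨x, P x⟩) :=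
    (List.prefix_iff_eq_take.1 (List.takeWhile_prefix _)).symm
  have hdrop : B.drop (B.takeWhile fun x =>
      decide (InsertOp.TimestampLT ⟨e, P e⟩ ⟨x, P x⟩)).length =
      B.dropWhile fun x => decide (InsertOp.TimestampLT ⟨e, P e⟩ ⟨x, P x⟩) := by
    conv_lhs => rw [← h1]
    rw [List.drop_append, h1]
    simp
  rw [htake, hdrop, List.append_assoc]

variable {sort : EventGraph ID C → List (Evt ID C)} {G : EventGraph ID C}

theorem swapBelow_rga (hsort : IsSorter sort)
    (hG : Valid (replay (rga ID C) .never sort) G) (n : ℕ)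
    (hok : ∀ u e, u.length < n → TopFrom G (pastOf G) ∅ (u ++ [e]) →
        StepOK (pastOf G) (targetOf (replay (rga ID C) .never sort) G)
          (order (rga ID C) (pastOf G) (targetOf (replay (rga ID C) .never sort) G) u) e) :
    SwapBelow (rga ID C) (pastOf G) (targetOf (replay (rga ID C) .never sort) G) G n := by
  refine swapBelow_of_insert fun es a b hlen htop hab ha hb => ?_
  have hM := model_targetOf (R := rga ID C) hsort hG.wellFormed .never
  have htop' := topFrom_swap (w := []) htop hab
  simp only [List.length_append, List.length_cons, List.length_nil] at hlen
  have hoka := hok es a (by omega) (by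
    rw [show es ++ [a, b] = (es ++ [a]) ++ [b] by simp] at htop
    exact (topFrom_append.1 htop).1)
  have hokb := hok es b (by omega) (by
    rw [show es ++ b :: a :: [] = (es ++ [b]) ++ [a] by simp] at htop'
    exact (topFrom_append.1 htop').1)
  obtain ⟨htopes, haG, haes, haP, hbG, hbes, hbP, -⟩ := topFrom_append.1 htop
  have hbaP : b ∉ pastOf G a := fun h => hbes (Set.mem_insert_of_mem _ (haP b h))
  have hne : a ≠ b := fun h => hbes (h ▸ Set.mem_insert _ _)
  obtain ⟨i, c, hai⟩ := ha
  obtain ⟨j, c', hbj⟩ := hb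
  have hvis : ∀ x ∈ G, ∀ y ∈ G, x ∉ pastOf G y →
      visibleIn (targetOf (replay (rga ID C) .never sort) G) (pastOf G y) x = false := by
    intro x hx y hy hxy
    simp only [visibleIn, decide_eq_false_iff_not]
    exact fun h => hxy (hM.mem_of_charState_ne_zero (hM.past_subset y hy) (hM.past_trans y hy) hx
      (ne_of_eq_of_ne h one_ne_zero))
  rw [order_append, order_append]
  simp only [List.foldl_cons, List.foldl_nil, integrate_rga hM haG hai, integrate_rga hM hbG hbj]
  refine insertAfterNth_comm (fun _ _ _ h h' => h.trans h') ?_ (hoka.1 i c hai) (hokb.1 j c' hbj)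
    (hvis a haG b hbG hab) (hvis b hbG a haG hbaP)
  rcases InsertOp.timestampLT_or (a := ⟨a, pastOf G a⟩) (b := ⟨b, pastOf G b⟩)
    (fun h => hne (hG.unique_id a haG b hbG h)) with h | h
  · exact Or.inl ⟨h, fun h' => (h.trans h').irrefl⟩
  · exact Or.inr ⟨h, fun h' => (h.trans h').irrefl⟩

theorem rga_isListCRDT : (rga ID C).IsListCRDT := by
  intro sort hsort G hG es a b rest hes hab ha hb
  have hM := model_targetOf (R := rga ID C) hsort hG.wellFormed .never
  have hconv := convergence hsort hG fun n hok => swapBelow_rga hsort hG n hok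
  have htop := hes.topFrom hG.wellFormed
  have hbG : b ∈ G := (htop.mem (x := b) (by simp)).1
  rw [show es ++ a :: b :: rest = (es ++ [a, b]) ++ rest by simp, topFrom_append] at htop
  have habP : a ∉ pastOf G b := fun h => hab ((mem_past hbG).1 h)
  have htop' := topFrom_swap (w := []) htop.1 habP
  rw [recordIds_walk_never hG.wellFormed hM htop.1 (hconv _).1,
    recordIds_walk_never hG.wellFormed hM htop' (hconv _).1,
    (hconv _).2 es a b le_rfl htop.1 habP]

end Rga

/-! ### The strong list specification -/

theorem order_sublist {R : IntegrationRule ID C} {P : Evt ID C → EventGraph ID C}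
    {T : Evt ID C → Option ID} (u w : List (Evt ID C)) :
    (order R P T u).Sublist (order R P T (u ++ w)) := by
  induction w using List.reverseRecOn with
  | nil => simp
  | append_singleton w e ih =>
    rw [← List.append_assoc, order_concat]
    refine ih.trans ?_
    rcases e.isInsert_or_delete with he | ⟨k, he⟩
    · obtain ⟨A, B, h1, h2⟩ :=
        integrate_insert (R := R) (P := P) (T := T) (l := order R P T (u ++ w)) he
      rw [h2, h1]
      exact List.Sublist.append_left (List.sublist_cons_self _ _) _
    · rw [integrate_delete he]

theorem map_fst_filterMap_entry {l : List (Evt ID C)} (hl : ∀ x ∈ l, x.IsInsert) :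
    (l.filterMap Evt.entry).map Prod.fst = l.map Evt.id := by
  induction l with
  | nil => rfl
  | cons a l ih =>
    obtain ⟨i, c, h⟩ := hl a (by simp)
    have : a.entry = some (a.id, c) := by simp [Evt.entry, h]
    rw [List.filterMap_cons_some this]
    simp [ih fun x hx => hl x (by simp [hx])]

theorem Evt.entry_eq_some {x : Evt ID C} {p : ID × C} :
    x.entry = some p ↔ x.id = p.1 ∧ ∃ j, x.op = .insert j p.2 := by
  obtain ⟨id, c⟩ := p
  cases h : x.op <;> simp [Evt.entry, h]

theorem mem_docOf {T : Evt ID C → Option ID} {l D : List (Evt ID C)} {p : ID × C} :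
    p ∈ docOf T l D ↔ ∃ x ∈ l, ¬ DeletedIn T D x ∧ x.entry = some p := by
  simp only [docOf, List.mem_filterMap, List.mem_filter, decide_eq_true_eq]
  exact ⟨fun ⟨x, ⟨h1, h2⟩, h3⟩ => ⟨x, h1, h2, h3⟩, fun ⟨x, h1, h2, h3⟩ => ⟨x, ⟨h1, h2⟩, h3⟩⟩

/-- The order of the positions in `L`, where elements that do not occur come last. -/
def listOrder [LinearOrder ID] (L : List ID) (a b : ID) : Prop :=
  L.idxOf a < L.idxOf b ∨ (L.idxOf a = L.idxOf b ∧ a < b)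

theorem pairwise_listOrder [LinearOrder ID] {L : List ID} (hL : L.Nodup) :
    L.Pairwise (listOrder L) := by
  rw [List.pairwise_iff_getElem]
  intro i j hi hj hij
  refine Or.inl ?_
  rwa [hL.idxOf_getElem i hi, hL.idxOf_getElem j hj]

variable {R : IntegrationRule ID C} {sort : EventGraph ID C → List (Evt ID C)}
  {pol : ClearingPolicy ID C} {G : EventGraph ID C}

/-- The optimisations change neither the replayed documents nor the notion of validity. -/
theorem Valid.never (hR : R.IsListCRDT) (hsort : IsSorter sort)
    (hG : Valid (replay R pol sort) G) :
    Valid (replay R .never sort) G ∧ replay R pol sort G = replay R .never sort G := by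
  induction hn : G.card using Nat.strong_induction_on generalizing G with
  | _ n ih =>
    subst hn
    have hV : Valid (replay R .never sort) G := by
      refine ⟨hG.unique_id, hG.parents_mem, hG.acyclic, fun e he => ?_⟩
      have hlt : (events G e.parents).card < G.card :=
        Finset.card_lt_card ⟨events_subset _ _, fun h => hG.wellFormed.notMem_past he (h he)⟩
      rw [← (ih _ hlt ((downClosed_past he).valid hG) rfl).2]
      exact hG.inBounds e he
    have hM := model_targetOf (R := R) hsort hV.wellFormed .never
    have hconv := convergence hsort hV (hR.swapBelow hsort hV)
    refine ⟨hV, ?_⟩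
    rw [replay_eq_docOf hsort hV.wellFormed hM pol (DownClosed.refl G) (hconv _).1,
      replay_eq_docOf hsort hV.wellFormed hM .never (DownClosed.refl G) (hconv _).1]

theorem strongListSpec [LinearOrder ID] (hR : R.IsListCRDT) (pol : ClearingPolicy ID C)
    (hsort : IsSorter sort) : StrongListSpec (replay R pol sort) := by
  intro G hGpol
  obtain ⟨hG, -⟩ := hGpol.never hR hsort
  have hW := hG.wellFormed
  have hM := model_targetOf (R := R) hsort hW .never
  have hconv := convergence hsort hG (hR.swapBelow hsort hG)
  have hdoc : ∀ pol' H, DownClosed G H → replay R pol' sort H = _ := fun pol' H hH =>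
    replay_eq_docOf hsort hW hM pol' hH (hconv _).1
  set T := targetOf (replay R .never sort) G with hT
  have hsortH : ∀ H, DownClosed G H →
      TopFrom G (pastOf G) ∅ (sort H) ∧ ∀ x, x ∈ sort H ↔ x ∈ H := fun H hH => by
    obtain ⟨h1, h2⟩ := sort_topFrom hsort hW hH
    exact ⟨h1.congr fun x hx => ⟨hH.1 ((h2 x).1 hx), rfl⟩, h2⟩
  have hcongr : ∀ u w, TopFrom G (pastOf G) ∅ u → TopFrom G (pastOf G) ∅ w →
      (∀ x, x ∈ u ↔ x ∈ w) → order R (pastOf G) T u = order R (pastOf G) T w := fun u w hu hw h =>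
    (hconv u.length).2.order_congr le_rfl hu hw h
  set full := order R (pastOf G) T (sort G) with hfull
  have hfullG : ∀ x ∈ full, x ∈ G := fun x hx =>
    ((hsortH G (.refl G)).2 x).1 (mem_order.1 hx).1
  have hnodup : (full.map Evt.id).Nodup :=
    (order_nodup (hsortH G (.refl G)).1.nodup).map_on fun x hx y hy =>
      hW.unique_id x (hfullG x hx) y (hfullG y hy)
  refine ⟨listOrder (full.map Evt.id), fun e he => ?_, ?_, ?_, ?_⟩
  · have hGe := downClosed_insert_past he
    obtain ⟨htop, hmem⟩ := hsortH _ hGe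
    dsimp only
    rw [hdoc pol _ hGe]
    set s := sort (insert e (events G e.parents)) with hs
    refine ⟨fun id c => ?_, ?_, ?_⟩
    · rw [← List.mem_iff_getElem?, mem_docOf]
      constructor
      · rintro ⟨x, hx, hdel, hentry⟩
        obtain ⟨hxs, hxI⟩ := mem_order.1 hx
        obtain ⟨hid, j, hop⟩ := Evt.entry_eq_some.1 hentry
        refine ⟨⟨x, (hmem x).1 hxs, j, hid, hop⟩, ?_⟩
        rintro ⟨b, hb, k, hbk, hget⟩
        have hbG : b ∈ G := hGe.1 hb
        rw [hdoc pol _ (downClosed_past hbG), ← hdoc .never _ (downClosed_past hbG)] at hget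
        refine hdel ⟨b, (hmem b).2 hb, fun h => ?_, ?_⟩
        · rw [h, hop] at hbk
          cases hbk
        · simp only [hT, targetOf, hbk, hget, Option.map_some, hid]
      · rintro ⟨⟨x, hx, j, hid, hop⟩, hdel⟩
        have hxG : x ∈ G := hGe.1 hx
        refine ⟨x, mem_order.2 ⟨(hmem x).2 hx, j, c, hop⟩, ?_, Evt.entry_eq_some.2 ⟨hid, j, hop⟩⟩
        rintro ⟨b, hb, hbx, hTb⟩
        have hbG : b ∈ G := (htop.mem hb).1
        rcases b.isInsert_or_delete with hbI | ⟨k, hbk⟩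
        · rw [hM.target_insert b hbG hbI] at hTb
          exact hbx (hW.unique_id b hbG x hxG (Option.some.inj hTb))
        · simp only [hT, targetOf, hbk, Option.map_eq_some_iff] at hTb
          obtain ⟨p, hp, hpx⟩ := hTb
          refine hdel ⟨b, (hmem b).1 hb, k, hbk, ?_⟩
          have hpast := downClosed_past hbG
          rw [hdoc pol _ hpast, ← hdoc .never _ hpast, hp]
          have hpm := List.mem_of_getElem? hp
          rw [hdoc .never _ hpast, mem_docOf] at hpm
          obtain ⟨y, hy, -, hye⟩ := hpm
          obtain ⟨hyid, j', hyop⟩ := Evt.entry_eq_some.1 hye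
          have hyG : y ∈ G := hpast.1 (((hsortH _ hpast).2 y).1 (mem_order.1 hy).1)
          have hyx : y = x := hW.unique_id y hyG x hxG (hyid.trans hpx)
          subst hyx
          rw [hop] at hyop
          obtain ⟨p1, p2⟩ := p
          simp only [Op.insert.injEq] at hyop
          simp only at hpx
          rw [hyop.2, hpx, hid]
    · intro i j idi ci idj cj hi hj hij
      have hsub : ((docOf T (order R (pastOf G) T s) s).map Prod.fst).Sublist
          (full.map Evt.id) := by
        rw [docOf, map_fst_filterMap_entry fun x hx => (mem_order.1 (List.mem_filter.1 hx).1).2]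
        refine List.Sublist.map _ (List.filter_sublist.trans ?_)
        have hfs := hsortH G (.refl G)
        rw [hfull, hcongr (sort G) _ hfs.1 (htop.append_filter hfs.1) fun x => by
          simp only [List.mem_append, List.mem_filter, decide_eq_true_eq]
          have h1 := hfs.2 x
          have h2 : x ∈ s → x ∈ G := fun h => (htop.mem h).1
          tauto]
        exact order_sublist _ _
      have hpw := (pairwise_listOrder hnodup).sublist hsub
      rw [List.pairwise_iff_getElem] at hpw
      obtain ⟨hi1, hi2⟩ := List.getElem?_eq_some_iff.1 hi
      obtain ⟨hj1, hj2⟩ := List.getElem?_eq_some_iff.1 hj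
      have := hpw i j (by simpa using hi1) (by simpa using hj1) hij
      simpa [hi2, hj2] using this
    · intro i c hop
      have hpast := downClosed_past he
      obtain ⟨htop', hmem'⟩ := hsortH _ hpast
      set t := sort (events G e.parents) with ht
      have het : e ∉ t := fun h => hW.notMem_past he ((hmem' e).1 h)
      have htope : TopFrom G (pastOf G) ∅ (t ++ [e]) :=
        topFrom_append.2 ⟨htop', he, by simpa using het, fun x hx => by
          simpa using (hmem' x).2 hx, trivial⟩
      have hst : ∀ x, x ∈ s ↔ x ∈ t ++ [e] := fun x => by
        rw [hmem x, Finset.mem_insert, List.mem_append, List.mem_singleton, hmem' x, or_comm]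
      have hnext : NextEvent (pastOf G) G t e := ⟨fun x hx => (htop'.mem hx).1,
        fun x hx y hy => htop'.past_subset hx hy, htop'.nodup, he, het,
        fun x hx => (hmem' x).2 hx⟩
      have heq := applyOp_of_past_eq (R := R) hM hnext (fun x hx => (hmem' x).1 hx)
        (fun x => mem_order) (order_nodup htop'.nodup)
        ((hconv (t.length + 1)).1 t e (by omega) htope)
      rw [hcongr s _ htop htope hst, order_concat,
        docOf_congr (D := s) (D' := t ++ [e]) (fun x _ => by simp only [DeletedIn, hst]), ← heq,
        hop]
      have hb := hG.inBounds e he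
      rw [hop, hdoc .never _ hpast] at hb
      simp only [applyOp]
      rw [List.getElem?_insertIdx_self]
      exact if_pos hb
  · rintro a b c (h | ⟨h1, h2⟩) (h' | ⟨h3, h4⟩)
    · exact Or.inl (h.trans h')
    · exact Or.inl (h3 ▸ h)
    · exact Or.inl (h1 ▸ h')
    · exact Or.inr ⟨h1.trans h3, h2.trans h4⟩
  · rintro a (h | ⟨-, h⟩) <;> exact lt_irrefl _ h
  · intro a b hab
    rcases lt_trichotomy ((full.map Evt.id).idxOf a) ((full.map Evt.id).idxOf b) with h | h | h
    · exact Or.inl (Or.inl h)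
    · rcases lt_or_gt_of_ne hab with h' | h'
      · exact Or.inl (Or.inr ⟨h, h'⟩)
      · exact Or.inr (Or.inr ⟨h.symm, h'⟩)
    · exact Or.inr (Or.inl h)

end

end EgWalker

theorem mainTheorem1 {ID : Type*} {C : Type*} [LinearOrder ID] :
    (EgWalker.rga ID C).IsListCRDT ∧
    ∀ R : EgWalker.IntegrationRule ID C, R.IsListCRDT →
      ∀ (pol : EgWalker.ClearingPolicy ID C)
        (sort : EgWalker.EventGraph ID C → List (EgWalker.Evt ID C)),
        EgWalker.IsSorter sort → EgWalker.StrongListSpec (EgWalker.replay R pol sort) :=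
  ⟨EgWalker.rga_isListCRDT, fun _ hR pol _ hsort => EgWalker.strongListSpec hR pol hsort⟩
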